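/- **Notation.** Let $n\ge 1$ and let $\mathbb F_n^+$ be the free semigroup on $g_1,\dots,g_n$ with identity $g_0$. Put $x_\alpha:=x_{i_1}\cdots x_{i_k}$ for $\alpha=g_{i_1}\cdots g_{i_k}$ and $x_{g_0}:=1$. All Hilbert spaces are complex, $B(\mathcal H)$ is the algebra of bounded operators on $\mathcal H$, $\mathcal H$ denotes a fixed infinite dimensional Hilbert space, and $[B(\mathcal H)^n]_r:=\{X: \|X_1X_1^*+\cdots+X_nX_n^*\|^{1/2}<r\}$. For a formal power series $F=\sum_\alpha a_\alpha Z_\alpha$ in noncommuting indeterminates $Z_1,\dots,Z_n$ and an $n$-tuple $X$ of bounded operators on a Hilbert space, $F(X):=\sum_{k\ge 0}\sum_{|\alpha|=k}a_\alpha X_\alpha$ whenever this converges (in norm or in the strong operator topology, SOT). **Model property.** Let $f=(f_1,\dots,f_n)$ be an $n$-tuple of formal power series. We write $\mathbb H^2(f)$ for the Hilbert space with orthonormal basis $\{f_\alpha\}_{\alpha\in\mathbb F_n^+}$, with elements $\sum_\alpha a_\alpha f_\alpha$, $\sum_\alpha|a_\alpha|^2<\infty$, and $M_u$ for left multiplication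 by $u$ on $\mathbb H^2(f)$. We say that $f$ has the *model property* if one of the following holds. * $(\mathcal A)$ $f$ is an $n$-tuple of noncommutative polynomials that is invertible, with respect to composition, in the $n$-tuples of noncommutative polynomials. Here $\mathbb H^2(f)$ is the completion of the space of polynomials $\sum_\alpha a_\alpha f_\alpha$ (finite sums), and $M_{Z_i}$ is the bounded extension of the multiplication by $Z_i$ of polynomials. * $(\mathcal S)$ $f(0)=0$; each $f_i=\sum_\alpha a^{(i)}_\alpha Z_\alpha$ has nonzero radius of convergence, i.e. $\limsup_k(\sum_{|\alpha|=k}|a^{(i)}_\alpha|^2)^{1/2k}<\infty$; $\det[\partial f_i/\partial Z_j(0)]_{i,j}\ne 0$; viewing the elements of $\mathbb H^2(f)$ as formal power series, $Z_1,\dots,Z_n\in\mathbb H^2(f)$ and each $M_{Z_i}$ is a bounded operator on $\mathbb H^2(f)$; and for $j=1,\dots,n$ the operator $M_{f_j}$ equals $f_j(M_{Z_1},\dots,M_{Z_n})$, where either, for all $j$, this series is SOT-convergent, or, for all $j$, there is $\delta\in(0,1)$ such that $f_j(rM_{Z_1},\dots,rM_{Z_n})$ is norm convergent for $r\in(\delta,1)$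 and $f_j(M_{Z_1},\dots,M_{Z_n})$ is understood as the SOT-limit of these operators as $r\to1$. * $(\mathcal F)$ For some $\gamma>0$ the series $f_i$ converge in norm on $[B(\mathcal H)^n]_\gamma$ and define a map $\varphi$ from $[B(\mathcal H)^n]_\gamma$ into $[B(\mathcal H)^n]_1$; the only formal power series $G$ that converges in norm on $[B(\mathcal H)^n]_1$ and satisfies $G\circ\varphi=0$ on $[B(\mathcal H)^n]_\gamma$ is $G=0$; and, with $\mathbb H^2(f):=\{G\circ\varphi: G=\sum_\alpha a_\alpha Z_\alpha,\ \sum_\alpha|a_\alpha|^2<\infty\}$, normed by $\|G\circ\varphi\|^2=\sum_\alpha|a_\alpha|^2$, the coordinate functions $X_1,\dots,X_n$ are in $\mathbb H^2(f)$, left multiplication $M_{Z_i}$ by $X_i$ is a bounded operator on $\mathbb H^2(f)$, and $M_{\varphi_j}=f_j(M_{Z_1},\dots,M_{Z_n})$ for $j=1,\dots,n$, in one of the two senses described in $(\mathcal S)$. **Universal model.** Let $f$ have the model property. The Hardy algebra $H^\infty(\mathbb B_f)\subseteq B(\mathbb H^2(f))$ is the closure in the weak operator topology (WOT) of the algebra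 of all polynomials in $M_{Z_1},\dots,M_{Z_n}$ and the identity. For a WOT-closed two-sided ideal $J$ of $H^\infty(\mathbb B_f)$ let $\mathcal N_{f,J}$ be the orthogonal complement in $\mathbb H^2(f)$ of the closed span of $\{\psi h:\psi\in J,\ h\in\mathbb H^2(f)\}$ and let $B_i:=P_{\mathcal N_{f,J}}M_{Z_i}|_{\mathcal N_{f,J}}$, $i=1,\dots,n$. **Theorem 6.1.** Let $f=(f_1,\dots,f_n)$ have the model property, let $J\ne H^\infty(\mathbb B_f)$ be a WOT-closed two-sided ideal of $H^\infty(\mathbb B_f)$, let $(B_1,\dots,B_n)$ be the corresponding universal model on $\mathcal N_{f,J}$, and let $\mathcal K$ be a Hilbert space. A closed subspace $\mathcal M\subseteq\mathcal N_{f,J}\otimes\mathcal K$ (Hilbert space tensor product) is invariant under each operator $B_1\otimes I_{\mathcal K},\dots,B_n\otimes I_{\mathcal K}$ if and only if there exist a Hilbert space $\mathcal G$ and a bounded operator $\Theta:\mathcal N_{f,J}\otimes\mathcal G\to\mathcal N_{f,J}\otimes\mathcal K$ such that 1. $\Theta$ is a partial isometry and $\Theta(B_i\otimes I_{\mathcal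 G})=(B_i\otimes I_{\mathcal K})\Theta$ for $i=1,\dots,n$; 2. $\mathcal M=\Theta(\mathcal N_{f,J}\otimes\mathcal G)$. -/

import Mathlib

open scoped ENNReal Topology TensorProduct

universe u v

namespace NCVariety

noncomputable section

/-! ### Formal power series in noncommuting indeterminates -/

/-- Formal power series `∑ a_α Z_α` in `n` noncommuting indeterminates with complex coefficients.
The words `α` of the free semigroup on `n` generators are lists over `Fin n`
(the empty list is the identity `g₀`, the length `|α|` is the length of the list). -/
def NCSeries (n : ℕ) : Type := List (Fin n) → ℂ

/-- The series `1`. -/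
instance (n : ℕ) : One (NCSeries n) := ⟨fun β => if β = [] then 1 else 0⟩

/-- The product of series: the coefficient at `β` of `F * G` is the sum over all factorizations
of `β` into two words. -/
instance (n : ℕ) : Mul (NCSeries n) :=
  ⟨fun F G β => ∑ k ∈ Finset.range (β.length + 1), F (β.take k) * G (β.drop k)⟩

/-- The indeterminate `Z_i`. -/
def NCSeries.Z {n : ℕ} (i : Fin n) : NCSeries n := fun β => if β = [i] then 1 else 0

/-- `x_α = x_{i₁} ⋯ x_{i_k}` for `α = g_{i₁} ⋯ g_{i_k}`, and `x_{g₀} = 1`. -/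
def wordProd {n : ℕ} {R : Type*} [Mul R] [One R] (x : Fin n → R) (α : List (Fin n)) : R :=
  (α.map x).prod

/-- The noncommutative polynomial with coefficients `s` evaluated at an `n`-tuple of elements of
an algebra. -/
def polyEval {n : ℕ} {A : Type*} [Semiring A] [Algebra ℂ A] (x : Fin n → A)
    (s : List (Fin n) →₀ ℂ) : A :=
  s.sum fun α z => z • wordProd x α

/-- For `f(0) = 0`: the formal power series `∑_α a_α f_α`. Since `f_α` has no terms of degree
below `|α|`, only words `α` with `|α| ≤ |β|` contribute to the coefficient at `β`. -/
def formalComp {n : ℕ} (a : List (Fin n) → ℂ) (f : Fin n → NCSeries n) : NCSeries n :=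
  fun β => ∑ k ∈ Finset.range (β.length + 1), ∑ w : Fin k → Fin n,
    a (List.ofFn w) * wordProd f (List.ofFn w) β

/-- `r(F)⁻¹ = limsup_k (∑_{|α| = k} |a_α|²)^{1/2k}`, the inverse of the radius of convergence. -/
def invRadius {n : ℕ} (F : NCSeries n) : ℝ≥0∞ :=
  Filter.limsup (fun k : ℕ =>
    (∑ w : Fin k → Fin n, ENNReal.ofReal (‖F (List.ofFn w)‖ ^ 2)) ^ (1 / (2 * (k : ℝ))))
    Filter.atTop

/-- The Jacobian matrix `[∂f_i / ∂Z_j (0)]`. -/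
def jacobianZero {n : ℕ} (f : Fin n → NCSeries n) : Matrix (Fin n) (Fin n) ℂ :=
  Matrix.of fun i j => f i [j]

/-! ### Evaluation at tuples of operators -/

section Evaluation

variable {n : ℕ} {H : Type*} [NormedAddCommGroup H] [InnerProductSpace ℂ H]

/-- The partial sum `∑_{k < m} ∑_{|α| = k} a_α X_α`. -/
def partialEval (a : List (Fin n) → ℂ) (X : Fin n → (H →L[ℂ] H)) (m : ℕ) : H →L[ℂ] H :=
  ∑ k ∈ Finset.range m, ∑ w : Fin k → Fin n, a (List.ofFn w) • wordProd X (List.ofFn w)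

/-- The series `∑_k ∑_{|α| = k} a_α X_α` converges to `Y` in the operator norm. -/
def EvalNorm (a : List (Fin n) → ℂ) (X : Fin n → (H →L[ℂ] H)) (Y : H →L[ℂ] H) : Prop :=
  Filter.Tendsto (partialEval a X) Filter.atTop (𝓝 Y)

/-- The series `∑_k ∑_{|α| = k} a_α X_α` converges to `Y` in the strong operator topology. -/
def EvalSOT (a : List (Fin n) → ℂ) (X : Fin n → (H →L[ℂ] H)) (Y : H →L[ℂ] H) : Prop :=
  ∀ h : H, Filter.Tendsto (fun m => partialEval a X m h) Filter.atTop (𝓝 (Y h))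

/-- There is `δ ∈ (0, 1)` such that the series converges in norm at `r X` for all `r ∈ (δ, 1)`,
and the values at `r X` tend to `Y` in the strong operator topology as `r → 1`. -/
def EvalRad (a : List (Fin n) → ℂ) (X : Fin n → (H →L[ℂ] H)) (Y : H →L[ℂ] H) : Prop :=
  ∃ δ ∈ Set.Ioo (0 : ℝ) 1, ∃ V : ℝ → (H →L[ℂ] H),
    (∀ r ∈ Set.Ioo δ 1, EvalNorm a (fun i => (r : ℂ) • X i) (V r)) ∧
    ∀ h : H, Filter.Tendsto (fun r => V r h) (𝓝[<] (1 : ℝ)) (𝓝 (Y h))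

/-- The open operatorial `n`-ball `{X : ‖X₁ X₁* + ⋯ + X_n X_n*‖^{1/2} < r}`. -/
def opBall (n : ℕ) (H : Type*) [NormedAddCommGroup H] [InnerProductSpace ℂ H] [CompleteSpace H]
    (r : ℝ) : Set (Fin n → (H →L[ℂ] H)) :=
  {X | Real.sqrt ‖∑ i, X i * ContinuousLinearMap.adjoint (X i)‖ < r}

end Evaluation

/-! ### The Hilbert space `ℍ²(f)` and tuples with the model property -/

/-- The Hilbert space `ℍ²(f)`, written in the coordinates of its orthonormal basis
`{f_α}`: the square-summable family `a` stands for `∑_α a_α f_α`. Which polynomial, formal power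
series or free holomorphic function this is, is recorded by `RepPoly`, `RepSeries`, `RepHol`. -/
abbrev H2 (n : ℕ) : Type := lp (fun _ : List (Fin n) => ℂ) 2

/-- The polynomial `P` is the finite sum `∑_α a_α p_α`. These elements are dense in the
completion `ℍ²(p)` of the span of the `p_α`. -/
def RepPoly {n : ℕ} (p : Fin n → FreeAlgebra ℂ (Fin n)) (a : H2 n)
    (P : FreeAlgebra ℂ (Fin n)) : Prop :=
  ∃ s : List (Fin n) →₀ ℂ, (∀ α, a α = s α) ∧ P = polyEval p s

/-- The formal power series `F` is `∑_α a_α f_α` (for `f(0) = 0`). -/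
def RepSeries {n : ℕ} (f : Fin n → NCSeries n) (a : H2 n) (F : NCSeries n) : Prop :=
  F = formalComp (fun α => a α) f

/-- The function `F` on `[B(H)^n]_γ` is `G ∘ φ`, where `G(Y) = ∑_k ∑_{|α| = k} a_α Y_α` is in
`H²_ball`. -/
def RepHol {n : ℕ} {H : Type*} [NormedAddCommGroup H] [InnerProductSpace ℂ H] [CompleteSpace H]
    (γ : ℝ) (φ : (Fin n → (H →L[ℂ] H)) → (Fin n → (H →L[ℂ] H))) (a : H2 n)
    (F : (Fin n → (H →L[ℂ] H)) → (H →L[ℂ] H)) : Prop :=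
  ∀ X ∈ opBall n H γ, EvalNorm (fun α => a α) (φ X) (F X)

/-- `T` is the operator of left multiplication by `u`, where `Rep a F` says that the element of
`ℍ²(f)` with coordinates `a` is `F`. -/
def IsLeftMultiplication {n : ℕ} {A : Type*} [Mul A] (Rep : H2 n → A → Prop) (u : A)
    (T : H2 n →L[ℂ] H2 n) : Prop :=
  ∀ a F, Rep a F → Rep (T a) (u * F)

/-- `M_{f_j} = f_j(M_{Z_1}, …, M_{Z_n})` for all `j`, where the tuple `(M_{Z_1}, …, M_{Z_n})`
is in the SOT convergence set of `f` or in the radial convergence set of `f`. -/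
def EvaluatesTo {n : ℕ} (f : Fin n → NCSeries n) (M Mf : Fin n → (H2 n →L[ℂ] H2 n)) : Prop :=
  (∀ j, EvalSOT (f j) M (Mf j)) ∨ (∀ j, EvalRad (f j) M (Mf j))

/-- `f` is an `n`-tuple of polynomials which is invertible with respect to composition
(property `(𝒜)`), and `M_i` is the left multiplication by `Z_i` on `ℍ²(f)`. -/
def PropertyA {n : ℕ} (f : Fin n → NCSeries n) (M : Fin n → (H2 n →L[ℂ] H2 n)) : Prop :=
  ∃ p q : Fin n → FreeAlgebra ℂ (Fin n),
    (∀ i, ∃ s : List (Fin n) →₀ ℂ, (∀ α, f i α = s α) ∧ p i = polyEval (FreeAlgebra.ι ℂ) s) ∧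
    (∀ i, FreeAlgebra.lift ℂ q (p i) = FreeAlgebra.ι ℂ i) ∧
    (∀ i, FreeAlgebra.lift ℂ p (q i) = FreeAlgebra.ι ℂ i) ∧
    ∀ i, IsLeftMultiplication (RepPoly p) (FreeAlgebra.ι ℂ i) (M i)

/-- `f` is an `n`-tuple of formal power series with `f(0) = 0` and property `(𝒮)`, and `M_i` is
the left multiplication by `Z_i` on `ℍ²(f)`. -/
structure PropertyS {n : ℕ} (f : Fin n → NCSeries n) (M : Fin n → (H2 n →L[ℂ] H2 n)) : Prop where
  map_zero : ∀ i, f i [] = 0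
  radius : ∀ i, invRadius (f i) < ⊤
  jacobian : (jacobianZero f).det ≠ 0
  mem : ∀ i, ∃ a : H2 n, RepSeries f a (NCSeries.Z i)
  mult : ∀ i, IsLeftMultiplication (RepSeries f) (NCSeries.Z i) (M i)
  eval : ∃ Mf : Fin n → (H2 n →L[ℂ] H2 n),
    (∀ j, IsLeftMultiplication (RepSeries f) (f j) (Mf j)) ∧ EvaluatesTo f M Mf

/-- `f` consists of the coefficients of an `n`-tuple `φ` of free holomorphic functions on some ball
`[B(H)^n]_γ` with property `(ℱ)`, and `M_i` is the left multiplication by the `i`-th coordinate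
function on `ℍ²(φ)`. -/
def PropertyF {n : ℕ} (H : Type*) [NormedAddCommGroup H] [InnerProductSpace ℂ H] [CompleteSpace H]
    (f : Fin n → NCSeries n) (M : Fin n → (H2 n →L[ℂ] H2 n)) : Prop :=
  ∃ γ : ℝ, 0 < γ ∧ ∃ φ : (Fin n → (H →L[ℂ] H)) → (Fin n → (H →L[ℂ] H)),
    -- `φ_i(X) = ∑_k ∑_{|α| = k} a_α^{(i)} X_α` on the ball, where `f_i = ∑ a_α^{(i)} Z_α`
    (∀ X ∈ opBall n H γ, ∀ i, EvalNorm (f i) X (φ X i)) ∧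
    (∀ X ∈ opBall n H γ, φ X ∈ opBall n H 1) ∧
    -- `φ` is not a right zero divisor for composition with free holomorphic functions
    (∀ G : NCSeries n, (∀ Y ∈ opBall n H 1, ∃ V, EvalNorm G Y V) →
      (∀ X ∈ opBall n H γ, EvalNorm G (φ X) 0) → ∀ α, G α = 0) ∧
    (∀ i, ∃ a : H2 n, RepHol γ φ a (fun X => X i)) ∧
    (∀ i, IsLeftMultiplication (RepHol γ φ) (fun X => X i) (M i)) ∧
    ∃ Mf : Fin n → (H2 n →L[ℂ] H2 n),
      (∀ j, IsLeftMultiplication (RepHol γ φ) (fun X => φ X j) (Mf j)) ∧ EvaluatesTo f M Mf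

/-- `f` has the model property, and `M = (M_{Z_1}, …, M_{Z_n})` is the tuple of left
multiplications by the indeterminates on `ℍ²(f)`. Free holomorphic functions are functions of
operators on `H`. -/
def HasModelProperty {n : ℕ} (H : Type*) [NormedAddCommGroup H] [InnerProductSpace ℂ H]
    [CompleteSpace H] (f : Fin n → NCSeries n) (M : Fin n → (H2 n →L[ℂ] H2 n)) : Prop :=
  PropertyA f M ∨ PropertyS f M ∨ PropertyF H f M

/-! ### The Hardy algebra, its ideals and the universal model of a noncommutative variety -/

/-- The closure of a set of operators in the weak operator topology. -/
def wotClosure {E : Type*} [NormedAddCommGroup E] [InnerProductSpace ℂ E] (S : Set (E →L[ℂ] E)) :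
    Set (E →L[ℂ] E) :=
  {T | ContinuousLinearMapWOT.ofCLM T ∈ closure (ContinuousLinearMapWOT.ofCLM '' S)}

/-- The Hardy algebra `H^∞(𝔹_f)`: the WOT-closure of all polynomials in the operators `M_i` and
the identity. -/
def hardyAlgebra {n : ℕ} (M : Fin n → (H2 n →L[ℂ] H2 n)) : Set (H2 n →L[ℂ] H2 n) :=
  wotClosure (Algebra.adjoin ℂ (Set.range M) : Set (H2 n →L[ℂ] H2 n))

/-- `J` is a WOT-closed two-sided ideal of the algebra `A` of operators. -/
structure IsWOTClosedIdeal {E : Type*} [NormedAddCommGroup E] [InnerProductSpace ℂ E]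
    (A : Set (E →L[ℂ] E)) (J : Submodule ℂ (E →L[ℂ] E)) : Prop where
  subset : (J : Set (E →L[ℂ] E)) ⊆ A
  mul_left : ∀ S ∈ A, ∀ T ∈ J, S * T ∈ J
  mul_right : ∀ S ∈ A, ∀ T ∈ J, T * S ∈ J
  closed : wotClosure (J : Set (E →L[ℂ] E)) ⊆ J

/-- `𝒩_{f,J} = ℍ²(f) ⊖ ℳ_{f,J}`, where `ℳ_{f,J}` is the closed span of `J ℍ²(f)`. -/
def varietySpace {n : ℕ} (J : Submodule ℂ (H2 n →L[ℂ] H2 n)) : Submodule ℂ (H2 n) :=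
  ((Submodule.span ℂ {y : H2 n | ∃ T ∈ J, ∃ x : H2 n, T x = y}).topologicalClosure)ᗮ

instance {n : ℕ} (J : Submodule ℂ (H2 n →L[ℂ] H2 n)) : CompleteSpace (varietySpace J) :=
  inferInstanceAs (CompleteSpace
    ((Submodule.span ℂ {y : H2 n | ∃ T ∈ J, ∃ x : H2 n, T x = y}).topologicalClosureᗮ :
      Submodule ℂ (H2 n)))

/-- The universal model `B_i = P_{𝒩_{f,J}} M_{Z_i} |_{𝒩_{f,J}}`. -/
def universalModel {n : ℕ} (M : Fin n → (H2 n →L[ℂ] H2 n)) (J : Submodule ℂ (H2 n →L[ℂ] H2 n))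
    (i : Fin n) : varietySpace J →L[ℂ] varietySpace J :=
  (varietySpace J).orthogonalProjectionOnto ∘L (M i ∘L (varietySpace J).subtypeL)

/-! ### Hilbert tensor products and partial isometries -/

/-- The Hilbert space tensor product: the completion of the algebraic tensor product. -/
abbrev HilbertTensor (E K : Type*) [NormedAddCommGroup E] [InnerProductSpace ℂ E]
    [NormedAddCommGroup K] [InnerProductSpace ℂ K] : Type _ :=
  UniformSpace.Completion (E ⊗[ℂ] K)

/-- The operator `T ⊗ I_K`. -/
def ampliation {E : Type*} [NormedAddCommGroup E] [InnerProductSpace ℂ E] (K : Type*)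
    [NormedAddCommGroup K] [InnerProductSpace ℂ K] (T : E →L[ℂ] E) :
    HilbertTensor E K →L[ℂ] HilbertTensor E K :=
  (T.rTensor K).completion

/-- A partial isometry: an operator which is isometric on the orthogonal complement of its
kernel. -/
def IsPartialIsometry {E F : Type*} [NormedAddCommGroup E] [InnerProductSpace ℂ E]
    [NormedAddCommGroup F] [InnerProductSpace ℂ F] (Θ : E →L[ℂ] F) : Prop :=
  ∀ x ∈ (LinearMap.ker (Θ : E →ₗ[ℂ] F))ᗮ, ‖Θ x‖ = ‖x‖

end

end NCVariety

/-! In the coordinates of the basis `f_α`, left multiplication by `f_j` is the left creation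
operator `L_j`, and left multiplications commute with the right creation operators `R_β`. These
facts are all that the model property contributes. Both follow once a vector of `ℍ²(f)` is known to
be determined by the object it represents. In case (𝒜) this comes from the compositional inverse, in
case (𝒮) from the invertible Jacobian, and in case (ℱ) from the condition on `G ∘ φ`. Since `f_j(M)
= L_j`, every `L_j` is a strong limit of a sequence from the norm closed algebra generated by the
`M_i` (`HasModelProperty.exists_seq`). Since commutation with `R_β` passes to WOT limits, the whole
Hardy algebra, and so `J`, commutes with every `R_β`.

Let `P` be the projection onto `N = 𝒩_{f,J}`. Its kernel is the closed span of `J ℍ²(f)`, which each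
`M_i` leaves invariant, so `B_i P = P M_i`. If `𝓜` is invariant, then `𝓛 = (P ⊗ I)⁻¹ 𝓜` is closed
and invariant under the `M_i ⊗ I`, hence under the `L_j ⊗ I`. A Wold decomposition
(`exists_isometry_of_invariant`) produces an isometry `Ψ : ℍ²(f) ⊗ G → ℍ²(f) ⊗ K` with range `𝓛`
that intertwines the `L_j`. By `comp_ampMap_of_commute_rightOp`, `Ψ` also intertwines `S ⊗ I` for
every `S` commuting with the `R_β`, in particular for `S = M_i` and for `S ∈ J`.

Because `P S = 0` for `S ∈ J`, the operator `(P ⊗ I) Ψ` vanishes on `ker P ⊗ G` and descends to `Θ`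
with `Θ (P ⊗ I) = (P ⊗ I) Ψ`. This `Θ` has range `𝓜` and intertwines the `B_i`. It is a partial
isometry since each vector of its range has a preimage of no larger norm
(`isPartialIsometry_of_compression`). The converse holds because the range of an intertwiner is
invariant. -/

namespace NCVariety

noncomputable section

/-! ### Operators on Hilbert space tensor products -/

section Tensor

open UniformSpace

variable {E F D K X : Type*} [NormedAddCommGroup E] [InnerProductSpace ℂ E]
  [NormedAddCommGroup F] [InnerProductSpace ℂ F] [NormedAddCommGroup D] [InnerProductSpace ℂ D]
  [NormedAddCommGroup K] [InnerProductSpace ℂ K]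
  [NormedAddCommGroup X] [NormedSpace ℂ X]

/-- The elementary tensor `x ⊗ k` in the Hilbert space tensor product, as a bounded bilinear
map. -/
def htmul (E K : Type*) [NormedAddCommGroup E] [InnerProductSpace ℂ E]
    [NormedAddCommGroup K] [InnerProductSpace ℂ K] : E →L[ℂ] K →L[ℂ] HilbertTensor E K :=
  (ContinuousLinearMap.compL ℂ K (E ⊗[ℂ] K) (HilbertTensor E K) Completion.toComplL) ∘L
    TensorProduct.mkL ℂ E K

theorem htmul_apply (x : E) (k : K) :
    htmul E K x k = ((x ⊗ₜ[ℂ] k : E ⊗[ℂ] K) : HilbertTensor E K) := rfl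

theorem inner_htmul (x y : E) (k l : K) :
    inner ℂ (htmul E K x k) (htmul E K y l) = inner ℂ x y * inner ℂ k l := by
  simp [htmul_apply]

theorem norm_htmul (x : E) (k : K) : ‖htmul E K x k‖ = ‖x‖ * ‖k‖ := by
  simp [htmul_apply]

theorem hilbertTensor_ext {A B : HilbertTensor E K →L[ℂ] X}
    (h : ∀ x k, A (htmul E K x k) = B (htmul E K x k)) : A = B := by
  ext z
  refine Completion.induction_on z (isClosed_eq A.continuous B.continuous) fun t => ?_
  induction t with
  | zero => rw [Completion.coe_zero, map_zero, map_zero]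
  | tmul x y => exact h x y
  | add x y hx hy => rw [Completion.coe_add, map_add, map_add, hx, hy]

theorem hilbertTensor_ext_of_dense {s : Set E}
    (hs : (Submodule.span ℂ s).topologicalClosure = ⊤) {A B : HilbertTensor E K →L[ℂ] X}
    (h : ∀ x ∈ s, ∀ k, A (htmul E K x k) = B (htmul E K x k)) : A = B := by
  refine hilbertTensor_ext fun x k => ?_
  have : A ∘L (htmul E K).flip k = B ∘L (htmul E K).flip k := by
    refine ContinuousLinearMap.ext_on (s := s) ?_ fun y hy => h y hy k
    rw [dense_iff_closure_eq]
    simpa using congrArg (fun p : Submodule ℂ E => (p : Set E)) hs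
  exact congrArg (fun f => f x) this

/-- The operator `T ⊗ I_K` for `T` between different spaces. -/
def ampMap (K : Type*) [NormedAddCommGroup K] [InnerProductSpace ℂ K] (T : E →L[ℂ] F) :
    HilbertTensor E K →L[ℂ] HilbertTensor F K :=
  (T.rTensor K).completion

@[simp]
theorem ampMap_htmul (T : E →L[ℂ] F) (x : E) (k : K) :
    ampMap K T (htmul E K x k) = htmul F K (T x) k := by
  rw [ampMap, htmul_apply, ContinuousLinearMap.completion_apply_coe]; rfl

theorem ampMap_comp (T : F →L[ℂ] D) (S : E →L[ℂ] F) :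
    ampMap K (T ∘L S) = ampMap K T ∘L ampMap K S :=
  hilbertTensor_ext fun x k => by simp

theorem ampMap_add (T S : E →L[ℂ] F) : ampMap K (T + S) = ampMap K T + ampMap K S :=
  hilbertTensor_ext fun x k => by simp

theorem ampMap_smul (c : ℂ) (T : E →L[ℂ] F) : ampMap K (c • T) = c • ampMap K T :=
  hilbertTensor_ext fun x k => by simp

theorem ampMap_id : ampMap K (ContinuousLinearMap.id ℂ E) = ContinuousLinearMap.id ℂ _ :=
  hilbertTensor_ext fun x k => by simp

theorem ampMap_zero : ampMap K (0 : E →L[ℂ] F) = 0 :=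
  hilbertTensor_ext fun x k => by simp

theorem norm_ampMap_le (T : E →L[ℂ] F) : ‖ampMap K T‖ ≤ ‖T‖ := by
  refine ContinuousLinearMap.opNorm_le_bound _ (norm_nonneg _) fun z => ?_
  refine Completion.induction_on z (isClosed_le (by fun_prop) (by fun_prop)) fun t => ?_
  rw [ampMap, ContinuousLinearMap.completion_apply_coe, Completion.norm_coe, Completion.norm_coe]
  exact (ContinuousLinearMap.le_opNorm _ _).trans
    (mul_le_mul_of_nonneg_right (ContinuousLinearMap.norm_rTensor_le _ _) (norm_nonneg _))

theorem continuous_ampMap :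
    Continuous (fun T : E →L[ℂ] F => (ampMap K T : HilbertTensor E K →L[ℂ] HilbertTensor F K)) := by
  suffices LipschitzWith 1
      (fun T : E →L[ℂ] F => (ampMap K T : HilbertTensor E K →L[ℂ] HilbertTensor F K)) from
    this.continuous
  refine LipschitzWith.of_dist_le_mul fun T S => ?_
  have h : ampMap K T - ampMap K S = ampMap K (T - S) := by
    rw [sub_eq_iff_eq_add, ← ampMap_add, sub_add_cancel]
  rw [dist_eq_norm, dist_eq_norm, h]
  simpa using norm_ampMap_le (K := K) (T - S)

/-- Both sides are continuous in each argument, so elementary tensors suffice, one slot at a time.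
This identifies the adjoint of `T ⊗ I` with `T* ⊗ I`. -/
theorem inner_ampMap_left [CompleteSpace E] [CompleteSpace F] (T : E →L[ℂ] F)
    (z : HilbertTensor E K) (z' : HilbertTensor F K) :
    inner ℂ (ampMap K T z) z' = inner ℂ z (ampMap K (ContinuousLinearMap.adjoint T) z') := by
  have h1 : ∀ (z : HilbertTensor E K) y l, inner ℂ (ampMap K T z) (htmul F K y l) =
      inner ℂ z (ampMap K (ContinuousLinearMap.adjoint T) (htmul F K y l)) := by
    intro z y l
    have : innerSL ℂ (htmul F K y l) ∘L ampMap K T =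
        innerSL ℂ (ampMap K (ContinuousLinearMap.adjoint T) (htmul F K y l)) := by
      refine hilbertTensor_ext fun x k => ?_
      simp [inner_htmul, ContinuousLinearMap.adjoint_inner_left]
    have h := congrArg (fun f => f z) this
    simp only [ContinuousLinearMap.comp_apply, innerSL_apply_apply] at h
    rw [← inner_conj_symm, h, inner_conj_symm]
  have h2 : innerSL ℂ (ampMap K T z) =
      innerSL ℂ z ∘L ampMap K (ContinuousLinearMap.adjoint T) :=
    hilbertTensor_ext fun y l => h1 z y l
  exact congrArg (fun f => f z') h2

/-- Strong convergence passes to ampliations. -/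
theorem tendsto_ampMap [CompleteSpace E] {T : ℕ → E →L[ℂ] F} {L : E →L[ℂ] F}
    (h : ∀ x, Filter.Tendsto (fun m => T m x) Filter.atTop (𝓝 (L x))) (z : HilbertTensor E K) :
    Filter.Tendsto (fun m => ampMap K (T m) z) Filter.atTop (𝓝 (ampMap K L z)) := by
  -- A strongly convergent sequence is bounded by Banach–Steinhaus. Boundedness makes the
  -- ampliations equicontinuous, so the vectors at which they converge form a closed set, and
  -- algebraic tensors suffice.
  obtain ⟨C, hC⟩ : ∃ C, ∀ m, ‖T m‖ ≤ C := by
    refine banach_steinhaus fun x => ?_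
    obtain ⟨C, hC⟩ := (h x).norm.bddAbove_range
    exact ⟨C, fun m => hC ⟨m, rfl⟩⟩
  have heq : Equicontinuous ((↑) ∘ fun m => ampMap K (T m)) :=
    by
      have := (NormedSpace.equicontinuous_TFAE (fun m => ampMap K (T m))).out 5 1
      exact this.mp ⟨C, fun m => (norm_ampMap_le _).trans (hC m)⟩
  have hcl := heq.isClosed_setOfPred_tendsto (l := Filter.atTop) (ampMap K L).continuous
  refine Completion.induction_on z hcl fun t => ?_
  induction t with
  | zero => simp only [Completion.coe_zero, map_zero, tendsto_const_nhds]
  | tmul x k =>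
    have : Filter.Tendsto (fun m => htmul F K (T m x) k) Filter.atTop (𝓝 (htmul F K (L x) k)) :=
      (((htmul F K).flip k).continuous.tendsto _).comp (h x)
    simpa [← htmul_apply] using this
  | add x y hx hy =>
    simp only [Completion.coe_add, map_add]
    exact hx.add hy

end Tensor

/-! ### Ampliations of isometries. -/

section Isometry

open UniformSpace

variable {E F K : Type*} [NormedAddCommGroup E] [InnerProductSpace ℂ E]
  [NormedAddCommGroup F] [InnerProductSpace ℂ F]
  [NormedAddCommGroup K] [InnerProductSpace ℂ K]

/-- The isometry `T ⊗ I_K` for an isometry `T`. -/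
def ampIsometry (K : Type*) [NormedAddCommGroup K] [InnerProductSpace ℂ K] (T : E →ₗᵢ[ℂ] F) :
    HilbertTensor E K →ₗᵢ[ℂ] HilbertTensor F K where
  toLinearMap := (ampMap K T.toContinuousLinearMap).toLinearMap
  norm_map' z := by
    change ‖ampMap K T.toContinuousLinearMap z‖ = ‖z‖
    refine Completion.induction_on z (isClosed_eq (by fun_prop) (by fun_prop)) fun t => ?_
    rw [ampMap, ContinuousLinearMap.completion_apply_coe, Completion.norm_coe,
      Completion.norm_coe, ← LinearIsometry.toContinuousLinearMap_rTensor]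
    exact LinearIsometry.norm_map _ _

theorem ampIsometry_apply (T : E →ₗᵢ[ℂ] F) (z : HilbertTensor E K) :
    ampIsometry K T z = ampMap K T.toContinuousLinearMap z := rfl

end Isometry

/-! ### The basis of `ℍ²(f)` and the shifts -/

section Shifts

variable {n : ℕ}

/-- The orthonormal basis `{f_α}` of `ℍ²(f)`. -/
def wordBasis (n : ℕ) : HilbertBasis (List (Fin n)) ℂ (H2 n) :=
  HilbertBasis.ofRepr (LinearIsometryEquiv.refl ℂ _)

theorem inner_wordBasis (α : List (Fin n)) (a : H2 n) : inner ℂ (wordBasis n α) a = a α :=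
  ((wordBasis n).repr_apply_apply a α).symm

theorem wordBasis_apply (α β : List (Fin n)) : wordBasis n α β = if β = α then 1 else 0 := by
  rw [← inner_wordBasis, orthonormal_iff_ite.mp (wordBasis n).orthonormal]

theorem hasSum_wordBasis (a : H2 n) : HasSum (fun α => a α • wordBasis n α) a :=
  (wordBasis n).hasSum_repr a

theorem span_wordBasis :
    (Submodule.span ℂ (Set.range (wordBasis n))).topologicalClosure = ⊤ :=
  (wordBasis n).dense_span

theorem clm_ext_wordBasis {X : Type*} [NormedAddCommGroup X] [NormedSpace ℂ X]
    {A B : H2 n →L[ℂ] X} (h : ∀ α, A (wordBasis n α) = B (wordBasis n α)) : A = B := by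
  ext a
  have hA := (hasSum_wordBasis a).mapL A
  have hB := (hasSum_wordBasis a).mapL B
  simp only [map_smul, h] at hA hB
  exact hA.unique hB

/-- The isometry of `ℍ²(f)` which maps `f_α` to `f_{σ α}`. -/
def wordShift (σ : List (Fin n) → List (Fin n)) (hσ : Function.Injective σ) : H2 n →ₗᵢ[ℂ] H2 n :=
  ((wordBasis n).orthonormal.comp σ hσ).orthogonalFamily.linearIsometry

@[simp]
theorem wordShift_wordBasis (σ : List (Fin n) → List (Fin n)) (hσ : Function.Injective σ)
    (α : List (Fin n)) : wordShift σ hσ (wordBasis n α) = wordBasis n (σ α) := by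
  have h := ((wordBasis n).orthonormal.comp σ hσ).orthogonalFamily.hasSum_linearIsometry
    (wordBasis n α)
  refine h.unique ?_
  convert hasSum_ite_eq α (wordBasis n (σ α)) using 2 with β
  by_cases hβ : β = α <;> simp [wordBasis_apply, hβ]

/-- The left creation operator `f_β ↦ f_{αβ}`. -/
def leftShift (α : List (Fin n)) : H2 n →ₗᵢ[ℂ] H2 n :=
  wordShift (fun β => α ++ β) (List.append_right_injective α)

/-- The right creation operator `f_α ↦ f_{αβ}`. -/
def rightShift (β : List (Fin n)) : H2 n →ₗᵢ[ℂ] H2 n :=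
  wordShift (fun α => α ++ β) (List.append_left_injective β)

@[simp]
theorem leftShift_wordBasis (α β : List (Fin n)) :
    leftShift α (wordBasis n β) = wordBasis n (α ++ β) := wordShift_wordBasis _ _ _

@[simp]
theorem rightShift_wordBasis (α β : List (Fin n)) :
    rightShift β (wordBasis n α) = wordBasis n (α ++ β) := wordShift_wordBasis _ _ _

/-- The left creation operator as a bounded operator. -/
def leftOp (α : List (Fin n)) : H2 n →L[ℂ] H2 n := (leftShift α).toContinuousLinearMap

/-- The right creation operator as a bounded operator. -/
def rightOp (β : List (Fin n)) : H2 n →L[ℂ] H2 n := (rightShift β).toContinuousLinearMap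

@[simp]
theorem leftOp_wordBasis (α β : List (Fin n)) :
    leftOp α (wordBasis n β) = wordBasis n (α ++ β) := leftShift_wordBasis _ _

@[simp]
theorem rightOp_wordBasis (α β : List (Fin n)) :
    rightOp β (wordBasis n α) = wordBasis n (α ++ β) := rightShift_wordBasis _ _

theorem leftOp_nil : leftOp ([] : List (Fin n)) = ContinuousLinearMap.id ℂ _ :=
  clm_ext_wordBasis fun α => by simp

theorem leftOp_append (α β : List (Fin n)) : leftOp (α ++ β) = leftOp α ∘L leftOp β :=
  clm_ext_wordBasis fun γ => by simp

theorem adjoint_leftOp_apply (α β : List (Fin n)) (a : H2 n) :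
    ContinuousLinearMap.adjoint (leftOp α) a β = a (α ++ β) := by
  rw [← inner_wordBasis, ContinuousLinearMap.adjoint_inner_right, leftOp_wordBasis,
    inner_wordBasis]

theorem adjoint_leftOp_comp_leftOp (i j : Fin n) :
    ContinuousLinearMap.adjoint (leftOp [j]) ∘L leftOp [i] =
      if i = j then ContinuousLinearMap.id ℂ (H2 n) else 0 := by
  refine clm_ext_wordBasis fun α => lp.ext (funext fun β => ?_)
  rw [ContinuousLinearMap.comp_apply, adjoint_leftOp_apply, leftOp_wordBasis, wordBasis_apply]
  by_cases h : i = j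
  · simp [h, wordBasis_apply]
  · simp [h, Ne.symm h]

theorem hasSum_rightOp_apply (a : H2 n) (β δ : List (Fin n)) :
    HasSum (fun γ => a γ * wordBasis n (γ ++ β) δ) (rightOp β a δ) := by
  have h := ((hasSum_wordBasis a).mapL (rightOp β)).mapL (innerSL ℂ (wordBasis n δ))
  simpa [inner_wordBasis] using h

theorem rightOp_apply_append (a : H2 n) (β γ : List (Fin n)) : rightOp β a (γ ++ β) = a γ := by
  have h := hasSum_rightOp_apply a β (γ ++ β)
  refine h.unique ?_
  convert hasSum_ite_eq γ (a γ) using 2 with α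
  by_cases hα : α = γ
  · simp [hα, wordBasis_apply]
  · simp [hα, wordBasis_apply, Ne.symm hα]

theorem rightOp_apply_eq_zero (a : H2 n) {β δ : List (Fin n)} (h : ¬ β <:+ δ) :
    rightOp β a δ = 0 := by
  refine (hasSum_rightOp_apply a β δ).unique ?_
  convert hasSum_zero using 2 with γ
  rw [wordBasis_apply, if_neg, mul_zero]
  rintro rfl
  exact h (List.suffix_append γ β)

end Shifts

/-! ### Coefficients of vectors of `ℍ²(f) ⊗ K` -/

section Coefficients

variable {n : ℕ} {K : Type*} [NormedAddCommGroup K] [InnerProductSpace ℂ K] [CompleteSpace K]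

/-- The coefficient at `f_γ` of a vector of `ℍ²(f) ⊗ K`. -/
def tensorCoeff (K : Type*) [NormedAddCommGroup K] [InnerProductSpace ℂ K] [CompleteSpace K]
    (γ : List (Fin n)) : HilbertTensor (H2 n) K →L[ℂ] K :=
  ContinuousLinearMap.adjoint (htmul (H2 n) K (wordBasis n γ))

@[simp]
theorem tensorCoeff_htmul (γ : List (Fin n)) (a : H2 n) (k : K) :
    tensorCoeff K γ (htmul (H2 n) K a k) = a γ • k := by
  refine ext_inner_left ℂ fun l => ?_
  rw [tensorCoeff, ContinuousLinearMap.adjoint_inner_right, inner_htmul, inner_wordBasis,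
    inner_smul_right]

theorem tensor_clm_ext {X : Type*} [NormedAddCommGroup X] [NormedSpace ℂ X]
    {K : Type*} [NormedAddCommGroup K] [InnerProductSpace ℂ K]
    {A B : HilbertTensor (H2 n) K →L[ℂ] X}
    (h : ∀ α k, A (htmul (H2 n) K (wordBasis n α) k) = B (htmul (H2 n) K (wordBasis n α) k)) :
    A = B :=
  hilbertTensor_ext_of_dense span_wordBasis (by rintro _ ⟨α, rfl⟩ k; exact h α k)

theorem tensorCoeff_ext {z z' : HilbertTensor (H2 n) K}
    (h : ∀ γ, tensorCoeff K γ z = tensorCoeff K γ z') : z = z' := by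
  have : innerSL ℂ z = innerSL ℂ z' := by
    refine tensor_clm_ext fun γ k => ?_
    rw [innerSL_apply_apply, innerSL_apply_apply,
      ← ContinuousLinearMap.adjoint_inner_left (htmul (H2 n) K (wordBasis n γ)),
      ← ContinuousLinearMap.adjoint_inner_left (htmul (H2 n) K (wordBasis n γ))]
    exact congrArg (fun l => inner ℂ l k) (h γ)
  exact ext_inner_right ℂ fun v => congrArg (fun f => f v) this

/-- The adjoint of `L_α` deletes the prefix `α`. This permits induction on the word at which a
coefficient is read. -/
theorem tensorCoeff_append (α γ : List (Fin n)) (z : HilbertTensor (H2 n) K) :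
    tensorCoeff K (α ++ γ) z =
      tensorCoeff K γ (ampMap K (ContinuousLinearMap.adjoint (leftOp α)) z) := by
  have : tensorCoeff K (α ++ γ) =
      tensorCoeff K γ ∘L ampMap K (ContinuousLinearMap.adjoint (leftOp α)) :=
    hilbertTensor_ext fun a k => by
      rw [ContinuousLinearMap.comp_apply, ampMap_htmul, tensorCoeff_htmul, tensorCoeff_htmul,
        adjoint_leftOp_apply]
  exact congrArg (fun f => f z) this

/-- The range of `L_γ` only involves words beginning with `γ`. Hence only the finitely many prefixes
of `δ` matter for the coefficient at `δ`. -/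
theorem tensorCoeff_ampMap_leftOp_of_not_prefix {γ δ : List (Fin n)} (h : ¬ γ <+: δ)
    (z : HilbertTensor (H2 n) K) : tensorCoeff K δ (ampMap K (leftOp γ) z) = 0 := by
  have : tensorCoeff K δ ∘L ampMap K (leftOp γ) = 0 := by
    refine tensor_clm_ext fun β k => ?_
    rw [ContinuousLinearMap.comp_apply, ampMap_htmul, leftOp_wordBasis, tensorCoeff_htmul,
      wordBasis_apply, if_neg, zero_smul, zero_apply]
    rintro rfl
    exact h (List.prefix_append γ β)
  exact congrArg (fun f => f z) this

end Coefficients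

/-! ### Multi-analytic isometries commute with the left multipliers -/

section Commutation

variable {n : ℕ} {K G : Type*} [NormedAddCommGroup K] [InnerProductSpace ℂ K] [CompleteSpace K]
  [NormedAddCommGroup G] [InnerProductSpace ℂ G]

/-- An operator which intertwines the ampliations of the left creation operators intertwines the
ampliations of all operators in the commutant of the right creation operators. -/
theorem comp_ampMap_of_commute_rightOp
    (Ψ : HilbertTensor (H2 n) G →L[ℂ] HilbertTensor (H2 n) K)
    (hΨ : ∀ α g, Ψ (htmul (H2 n) G (wordBasis n α) g) =
      ampMap K (leftOp α) (Ψ (htmul (H2 n) G (wordBasis n []) g)))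
    (S : H2 n →L[ℂ] H2 n) (hS : ∀ β, S ∘L rightOp β = rightOp β ∘L S) :
    Ψ ∘L ampMap G S = ampMap K S ∘L Ψ := by
  refine tensor_clm_ext fun α g => tensorCoeff_ext fun δ => ?_
  -- The vector `w` is `Ψ (f_∅ ⊗ g)`. With `a = S f_α`, the claim becomes that `∑_γ a_γ (L_γ ⊗ I) w`
  -- and `(S L_α ⊗ I) w` have the same coefficient at every `δ`.
  obtain ⟨w, hw⟩ : ∃ w, ∀ γ, Ψ (htmul (H2 n) G (wordBasis n γ) g) = ampMap K (leftOp γ) w :=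
    ⟨_, fun γ => hΨ γ g⟩
  set a := S (wordBasis n α) with ha
  have h1 : HasSum (fun γ => a γ • tensorCoeff K δ (ampMap K (leftOp γ) w))
      (tensorCoeff K δ (Ψ (htmul (H2 n) G a g))) := by
    have h := (((hasSum_wordBasis a).mapL ((htmul (H2 n) G).flip g)).mapL Ψ).mapL
      (tensorCoeff K δ)
    simpa [hw] using h
  have h2 : tensorCoeff K δ (Ψ (htmul (H2 n) G a g)) =
      ∑ γ ∈ δ.inits.toFinset, a γ • tensorCoeff K δ (ampMap K (leftOp γ) w) := by
    refine h1.unique (hasSum_sum_of_ne_finset_zero fun γ hγ => ?_)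
    rw [tensorCoeff_ampMap_leftOp_of_not_prefix (by simpa using hγ), smul_zero]
  -- After truncation to prefixes of `δ` both sides are bounded operators in `w`, so they can be
  -- compared on `f_β ⊗ k`. No convergence of `∑_γ a_γ L_γ` is needed. The comparison rests on `S
  -- f_{αβ} = S R_β f_α = R_β a`.
  have h3 : ∑ γ ∈ δ.inits.toFinset, a γ • (tensorCoeff K δ ∘L ampMap K (leftOp γ)) =
      tensorCoeff K δ ∘L ampMap K S ∘L ampMap K (leftOp α) := by
    refine tensor_clm_ext fun β k => ?_
    have hb : S (wordBasis n (α ++ β)) = rightOp β a := by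
      rw [ha, ← ContinuousLinearMap.comp_apply, ← hS, ContinuousLinearMap.comp_apply,
        rightOp_wordBasis]
    have hc : rightOp β a δ = ∑ γ ∈ δ.inits.toFinset, a γ * wordBasis n (γ ++ β) δ := by
      refine (hasSum_rightOp_apply a β δ).unique (hasSum_sum_of_ne_finset_zero fun γ hγ => ?_)
      rw [wordBasis_apply, if_neg, mul_zero]
      rintro rfl
      simp at hγ
    simp only [sum_apply, smul_apply,
      ContinuousLinearMap.comp_apply, ampMap_htmul, leftOp_wordBasis, tensorCoeff_htmul, hb, hc,
      Finset.sum_smul, smul_smul]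
  have h4 := congrArg (fun f => f w) h3
  simp only [sum_apply, smul_apply,
    ContinuousLinearMap.comp_apply] at h4
  rw [ContinuousLinearMap.comp_apply, ContinuousLinearMap.comp_apply, ampMap_htmul, h2, h4, hw]

end Commutation

/-! ### The Wold decomposition of an invariant subspace -/

section Wold

variable {n : ℕ} {K : Type*} [NormedAddCommGroup K] [InnerProductSpace ℂ K]

theorem ampMap_leftOp_append (α β : List (Fin n)) (z : HilbertTensor (H2 n) K) :
    ampMap K (leftOp (α ++ β)) z = ampMap K (leftOp α) (ampMap K (leftOp β) z) := by
  rw [leftOp_append, ampMap_comp, ContinuousLinearMap.comp_apply]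

theorem ampMap_leftOp_nil (z : HilbertTensor (H2 n) K) :
    ampMap K (leftOp []) z = z := by
  rw [leftOp_nil, ampMap_id, ContinuousLinearMap.id_apply]

theorem ampMap_adjoint_leftOp (i j : Fin n) (z : HilbertTensor (H2 n) K) :
    ampMap K (ContinuousLinearMap.adjoint (leftOp [j])) (ampMap K (leftOp [i]) z) =
      if i = j then z else 0 := by
  rw [← ContinuousLinearMap.comp_apply, ← ampMap_comp, adjoint_leftOp_comp_leftOp]
  split_ifs with h
  · rw [ampMap_id, ContinuousLinearMap.id_apply]
  · rw [ampMap_zero, zero_apply]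

theorem inner_ampMap_leftOp (i j : Fin n) (z z' : HilbertTensor (H2 n) K) :
    inner ℂ (ampMap K (leftOp [i]) z) (ampMap K (leftOp [j]) z') =
      if i = j then inner ℂ z z' else 0 := by
  rw [inner_ampMap_left, ampMap_adjoint_leftOp]
  by_cases h : i = j
  · simp [h]
  · simp [h, Ne.symm h]

/-- The closed span of the images of `𝓛` under the operators `L_j ⊗ I`. -/
def shiftedSubspace (𝓛 : Submodule ℂ (HilbertTensor (H2 n) K)) :
    Submodule ℂ (HilbertTensor (H2 n) K) :=
  (⨆ j : Fin n, 𝓛.map (ampMap K (leftOp [j])).toLinearMap).topologicalClosure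

/-- The wandering subspace of `𝓛`. -/
def wandering (𝓛 : Submodule ℂ (HilbertTensor (H2 n) K)) :
    Submodule ℂ (HilbertTensor (H2 n) K) :=
  𝓛 ⊓ (shiftedSubspace 𝓛)ᗮ

variable {𝓛 : Submodule ℂ (HilbertTensor (H2 n) K)}

theorem ampMap_leftOp_mem (hinv : ∀ j, ∀ z ∈ 𝓛, ampMap K (leftOp [j]) z ∈ 𝓛) (α : List (Fin n)) :
    ∀ z ∈ 𝓛, ampMap K (leftOp α) z ∈ 𝓛 := by
  induction α with
  | nil => intro z hz; rwa [ampMap_leftOp_nil]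
  | cons j α ih =>
    intro z hz
    rw [show j :: α = [j] ++ α from rfl, ampMap_leftOp_append]
    exact hinv j _ (ih z hz)

theorem ampMap_mem_shiftedSubspace (j : Fin n) {z : HilbertTensor (H2 n) K} (hz : z ∈ 𝓛) :
    ampMap K (leftOp [j]) z ∈ shiftedSubspace 𝓛 :=
  Submodule.le_topologicalClosure _ (Submodule.mem_iSup_of_mem j ⟨z, hz, rfl⟩)

theorem inner_wandering_cons (hinv : ∀ j, ∀ z ∈ 𝓛, ampMap K (leftOp [j]) z ∈ 𝓛)
    {w z : HilbertTensor (H2 n) K} (hw : w ∈ wandering 𝓛) (hz : z ∈ 𝓛) (j : Fin n)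
    (α : List (Fin n)) : inner ℂ (ampMap K (leftOp (j :: α)) z) w = 0 := by
  rw [show j :: α = [j] ++ α from rfl, ampMap_leftOp_append]
  exact hw.2 _ (ampMap_mem_shiftedSubspace j (ampMap_leftOp_mem hinv α z hz))

/-- Equal first letters cancel because `L_i` is isometric, and different ones give orthogonal
ranges. If one word runs out, the other vector lies in the shifted subspace, to which wandering
vectors are orthogonal. -/
theorem inner_wandering_of_ne (hinv : ∀ j, ∀ z ∈ 𝓛, ampMap K (leftOp [j]) z ∈ 𝓛)
    {w w' : HilbertTensor (H2 n) K} (hw : w ∈ wandering 𝓛) (hw' : w' ∈ wandering 𝓛)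
    {α β : List (Fin n)} (h : α ≠ β) :
    inner ℂ (ampMap K (leftOp α) w) (ampMap K (leftOp β) w') = 0 := by
  induction α generalizing β with
  | nil =>
    cases β with
    | nil => exact absurd rfl h
    | cons j β =>
      rw [ampMap_leftOp_nil, inner_eq_zero_symm]
      exact inner_wandering_cons hinv hw hw'.1 j β
  | cons i α ih =>
    cases β with
    | nil =>
      rw [ampMap_leftOp_nil]
      exact inner_wandering_cons hinv hw' hw.1 i α
    | cons j β =>
      rw [show i :: α = [i] ++ α from rfl, show j :: β = [j] ++ β from rfl,
        ampMap_leftOp_append, ampMap_leftOp_append, inner_ampMap_leftOp]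
      split_ifs with hij
      · subst hij
        exact ih fun hαβ => h (by rw [hαβ])
      · rfl

/-- The isometry `w ↦ (L_α ⊗ I) w` on a subspace. -/
def wordEmbedding (W : Submodule ℂ (HilbertTensor (H2 n) K)) (α : List (Fin n)) :
    W →ₗᵢ[ℂ] HilbertTensor (H2 n) K :=
  (ampIsometry K (leftShift α)).comp W.subtypeₗᵢ

theorem orthogonalFamily_wandering (hinv : ∀ j, ∀ z ∈ 𝓛, ampMap K (leftOp [j]) z ∈ 𝓛) :
    OrthogonalFamily ℂ (fun _ : List (Fin n) => wandering 𝓛) (wordEmbedding (wandering 𝓛)) :=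
  fun _ _ h w w' => inner_wandering_of_ne hinv w.2 w'.2 h

/-- The adjoint of `L_j ⊗ I` maps the shifted subspace of `𝓛` into `𝓛`. -/
theorem ampMap_adjoint_mem (hcl : IsClosed (𝓛 : Set (HilbertTensor (H2 n) K))) (j : Fin n)
    {y : HilbertTensor (H2 n) K} (hy : y ∈ shiftedSubspace 𝓛) :
    ampMap K (ContinuousLinearMap.adjoint (leftOp [j])) y ∈ 𝓛 := by
  suffices shiftedSubspace 𝓛 ≤
      𝓛.comap (ampMap K (ContinuousLinearMap.adjoint (leftOp [j]))).toLinearMap from this hy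
  refine Submodule.topologicalClosure_minimal _ (iSup_le ?_)
    (hcl.preimage (ContinuousLinearMap.continuous _))
  refine fun i => Submodule.map_le_iff_le_comap.mpr fun z hz => ?_
  rw [Submodule.mem_comap, Submodule.mem_comap, ContinuousLinearMap.coe_coe,
    ContinuousLinearMap.coe_coe, ampMap_adjoint_leftOp]
  split_ifs
  · exact hz
  · exact 𝓛.zero_mem

/-- A vector of `𝓛` orthogonal to the wandering subspace lies in the shifted subspace. -/
theorem mem_shiftedSubspace_of_orthogonal (hinv : ∀ j, ∀ z ∈ 𝓛, ampMap K (leftOp [j]) z ∈ 𝓛)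
    (hcl : IsClosed (𝓛 : Set (HilbertTensor (H2 n) K)))
    {y : HilbertTensor (H2 n) K} (hy : y ∈ 𝓛) (hyw : ∀ w ∈ wandering 𝓛, inner ℂ w y = 0) :
    y ∈ shiftedSubspace 𝓛 := by
  have hc : IsClosed (shiftedSubspace 𝓛 : Set (HilbertTensor (H2 n) K)) :=
    Submodule.isClosed_topologicalClosure _
  have : CompleteSpace (shiftedSubspace 𝓛) := hc.completeSpace_coe
  have hle : shiftedSubspace 𝓛 ≤ 𝓛 := by
    refine Submodule.topologicalClosure_minimal _ (iSup_le ?_) hcl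
    rintro i _ ⟨z, hz, rfl⟩
    exact hinv i z hz
  obtain ⟨p, hp, q, hq, rfl⟩ := (shiftedSubspace 𝓛).exists_add_mem_mem_orthogonal y
  have hqL : q ∈ 𝓛 := by
    have := 𝓛.sub_mem hy (hle hp)
    rwa [add_sub_cancel_left] at this
  -- The component `q` of `y` orthogonal to the shifted subspace is itself wandering, so `⟨q, y⟩ =
  -- 0`, which is `‖q‖² = 0`.
  have h0 := hyw q ⟨hqL, hq⟩
  rw [inner_add_right, inner_eq_zero_symm.mp (hq p hp), zero_add, inner_self_eq_zero] at h0
  rwa [h0, add_zero]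

variable [CompleteSpace K]

/-- Vectors in the range of some `L_j ⊗ I` involve nonempty words only, and this survives closed
spans. -/
theorem tensorCoeff_nil_shiftedSubspace {y : HilbertTensor (H2 n) K}
    (hy : y ∈ shiftedSubspace 𝓛) : tensorCoeff K [] y = 0 := by
  suffices shiftedSubspace 𝓛 ≤ LinearMap.ker (tensorCoeff (n := n) K []).toLinearMap from this hy
  refine Submodule.topologicalClosure_minimal _ (iSup_le ?_)
    (isClosed_singleton.preimage (tensorCoeff (n := n) K []).continuous)
  rintro i _ ⟨z, -, rfl⟩
  exact tensorCoeff_ampMap_leftOp_of_not_prefix (by simp) z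

/-- A vector of `𝓛` orthogonal to all translates of the wandering subspace vanishes. -/
theorem eq_zero_of_orthogonal_wandering (hinv : ∀ j, ∀ z ∈ 𝓛, ampMap K (leftOp [j]) z ∈ 𝓛)
    (hcl : IsClosed (𝓛 : Set (HilbertTensor (H2 n) K)))
    {y : HilbertTensor (H2 n) K} (hy : y ∈ 𝓛)
    (hyw : ∀ α, ∀ w ∈ wandering 𝓛, inner ℂ (ampMap K (leftOp α) w) y = 0) : y = 0 := by
  refine tensorCoeff_ext fun γ => ?_
  rw [map_zero]
  -- The letters of `γ` are stripped one by one. Orthogonality to the wandering subspace puts `y` in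
  -- the shifted subspace, so its coefficient at the empty word vanishes. Moreover `(L_j* ⊗ I) y` is
  -- again in `𝓛` and orthogonal to all translates.
  induction γ generalizing y with
  | nil =>
    refine tensorCoeff_nil_shiftedSubspace (mem_shiftedSubspace_of_orthogonal hinv hcl hy ?_)
    intro w hw
    simpa [ampMap_leftOp_nil] using hyw [] w hw
  | cons j γ ih =>
    rw [show j :: γ = [j] ++ γ from rfl, tensorCoeff_append]
    refine ih (ampMap_adjoint_mem hcl j (mem_shiftedSubspace_of_orthogonal hinv hcl hy ?_)) ?_
    · intro w hw
      simpa [ampMap_leftOp_nil] using hyw [] w hw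
    · intro α w hw
      rw [← inner_ampMap_left, ← ampMap_leftOp_append]
      exact hyw _ w hw

/-- The range of the isometry assembled from the translates of the wandering subspace. -/
theorem range_wandering (hinv : ∀ j, ∀ z ∈ 𝓛, ampMap K (leftOp [j]) z ∈ 𝓛)
    (hcl : IsClosed (𝓛 : Set (HilbertTensor (H2 n) K))) :
    LinearMap.range (orthogonalFamily_wandering hinv).linearIsometry.toLinearMap = 𝓛 := by
  have hWc : IsClosed (wandering 𝓛 : Set (HilbertTensor (H2 n) K)) :=
    hcl.inter (Submodule.isClosed_orthogonal _)
  have : CompleteSpace (wandering 𝓛) := hWc.completeSpace_coe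
  rw [OrthogonalFamily.range_linearIsometry]
  set R := (⨆ α, LinearMap.range (wordEmbedding (wandering 𝓛) α).toLinearMap).topologicalClosure
    with hR
  have : CompleteSpace R := (Submodule.isClosed_topologicalClosure _).completeSpace_coe
  have hle : R ≤ 𝓛 := by
    refine Submodule.topologicalClosure_minimal _ (iSup_le ?_) hcl
    rintro α _ ⟨w, rfl⟩
    exact ampMap_leftOp_mem hinv α _ w.2.1
  refine le_antisymm hle fun y hy => ?_
  obtain ⟨p, hp, q, hq, rfl⟩ := R.exists_add_mem_mem_orthogonal y
  have hqL : q ∈ 𝓛 := by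
    have := 𝓛.sub_mem hy (hle hp)
    rwa [add_sub_cancel_left] at this
  rw [eq_zero_of_orthogonal_wandering hinv hcl hqL fun α w hw => hq _ ?_, add_zero]
  · exact hp
  · exact Submodule.le_topologicalClosure _ (Submodule.mem_iSup_of_mem α ⟨⟨w, hw⟩, rfl⟩)

/-- The isometry `g ↦ f_α ⊗ g`. -/
def basisTensor (G : Type*) [NormedAddCommGroup G] [InnerProductSpace ℂ G] (α : List (Fin n)) :
    G →ₗᵢ[ℂ] HilbertTensor (H2 n) G where
  toLinearMap := (htmul (H2 n) G (wordBasis n α)).toLinearMap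
  norm_map' g := by
    rw [ContinuousLinearMap.coe_coe, norm_htmul, (wordBasis n).orthonormal.1, one_mul]

theorem basisTensor_apply {G : Type*} [NormedAddCommGroup G] [InnerProductSpace ℂ G]
    (α : List (Fin n)) (g : G) : basisTensor G α g = htmul (H2 n) G (wordBasis n α) g := rfl

/-- `ℍ²(f) ⊗ G` is the Hilbert sum of the subspaces `f_α ⊗ G`. -/
theorem isHilbertSum_basisTensor (n : ℕ) (G : Type*) [NormedAddCommGroup G]
    [InnerProductSpace ℂ G] [CompleteSpace G] :
    IsHilbertSum ℂ (fun _ : List (Fin n) => G) (basisTensor G) := by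
  refine IsHilbertSum.mk (fun α β h g g' => ?_) ?_
  · rw [basisTensor_apply, basisTensor_apply, inner_htmul, (wordBasis n).orthonormal.2 h, zero_mul]
  · rw [top_le_iff, Submodule.topologicalClosure_eq_top_iff, eq_bot_iff]
    intro z hz
    refine tensorCoeff_ext (z' := 0) fun γ => ext_inner_left ℂ fun g => ?_
    rw [tensorCoeff, ContinuousLinearMap.adjoint_inner_right, map_zero, inner_zero_right]
    exact hz _ (Submodule.mem_iSup_of_mem γ ⟨g, rfl⟩)

/-- An orthogonal family of isometries of `G`, indexed by the words, is the same as an isometry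
of `ℍ²(f) ⊗ G`. -/
theorem exists_tensor_isometry {G X : Type*} [NormedAddCommGroup G] [InnerProductSpace ℂ G]
    [CompleteSpace G] [NormedAddCommGroup X] [InnerProductSpace ℂ X] [CompleteSpace X]
    {V : List (Fin n) → G →ₗᵢ[ℂ] X}
    (hV : OrthogonalFamily ℂ (fun _ : List (Fin n) => G) V) :
    ∃ Ψ : HilbertTensor (H2 n) G →ₗᵢ[ℂ] X,
      (∀ α g, Ψ (htmul (H2 n) G (wordBasis n α) g) = V α g) ∧
      Set.range Ψ = LinearMap.range hV.linearIsometry.toLinearMap := by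
  have hsum := isHilbertSum_basisTensor n G
  refine ⟨hV.linearIsometry.comp hsum.linearIsometryEquiv.toLinearIsometry, fun α g => ?_, ?_⟩
  · have h : hsum.linearIsometryEquiv (htmul (H2 n) G (wordBasis n α) g) = lp.single 2 α g := by
      rw [← LinearIsometryEquiv.eq_symm_apply, hsum.linearIsometryEquiv_symm_apply_single,
        basisTensor_apply]
    rw [LinearIsometry.coe_comp, Function.comp_apply, LinearIsometryEquiv.coe_toLinearIsometry, h,
      OrthogonalFamily.linearIsometry_apply_single]
  · rw [LinearIsometry.coe_comp, LinearIsometryEquiv.coe_toLinearIsometry,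
      hsum.linearIsometryEquiv.surjective.range_comp]
    rfl

end Wold

/-- Every closed subspace of `ℍ²(f) ⊗ K` invariant under the ampliations of the left creation
operators is the range of an isometry which intertwines these ampliations. -/
theorem exists_isometry_of_invariant {n : ℕ} {K : Type v} [NormedAddCommGroup K]
    [InnerProductSpace ℂ K] [CompleteSpace K] {𝓛 : Submodule ℂ (HilbertTensor (H2 n) K)}
    (hinv : ∀ j, ∀ z ∈ 𝓛, ampMap K (leftOp [j]) z ∈ 𝓛)
    (hcl : IsClosed (𝓛 : Set (HilbertTensor (H2 n) K))) :
    ∃ (G : Type v) (_ : NormedAddCommGroup G) (_ : InnerProductSpace ℂ G) (_ : CompleteSpace G)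
      (Ψ : HilbertTensor (H2 n) G →ₗᵢ[ℂ] HilbertTensor (H2 n) K),
      (∀ α g, Ψ (htmul (H2 n) G (wordBasis n α) g) =
        ampMap K (leftOp α) (Ψ (htmul (H2 n) G (wordBasis n []) g))) ∧
      Set.range Ψ = 𝓛 := by
  have hWc : IsClosed (wandering 𝓛 : Set (HilbertTensor (H2 n) K)) :=
    hcl.inter (Submodule.isClosed_orthogonal _)
  have hWcomp : CompleteSpace (wandering 𝓛) := hWc.completeSpace_coe
  -- The coefficient space is the wandering subspace itself, which also keeps `G` in the universe of
  -- `K`.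
  obtain ⟨Ψ, hΨ, hr⟩ := exists_tensor_isometry (G := wandering 𝓛)
    (V := wordEmbedding (wandering 𝓛)) (orthogonalFamily_wandering hinv)
  refine ⟨wandering 𝓛, _, _, hWcomp, Ψ, fun α w => ?_,
    hr.trans (congrArg _ (range_wandering hinv hcl))⟩
  exact (hΨ α w).trans (congrArg (ampMap K (leftOp α))
    ((hΨ [] w).trans (ampMap_leftOp_nil _)).symm)

/-! ### Invariant subspaces of compressions -/

section Compression

variable {n : ℕ}

/-- The operators `T` with `(T ⊗ I) 𝓛 ⊆ 𝓛` contain the norm closed algebra generated by any of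
their subsets. -/
theorem ampMap_mem_of_mem_adjoin_closure {E K : Type*} [NormedAddCommGroup E]
    [InnerProductSpace ℂ E] [NormedAddCommGroup K] [InnerProductSpace ℂ K]
    {𝓛 : Submodule ℂ (HilbertTensor E K)}
    (hcl : IsClosed (𝓛 : Set (HilbertTensor E K))) {s : Set (E →L[ℂ] E)}
    (hs : ∀ T ∈ s, ∀ z ∈ 𝓛, ampMap K T z ∈ 𝓛) {T : E →L[ℂ] E}
    (hT : T ∈ closure (Algebra.adjoin ℂ s : Set (E →L[ℂ] E))) {z : HilbertTensor E K}
    (hz : z ∈ 𝓛) : ampMap K T z ∈ 𝓛 := by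
  have hadj : ∀ T ∈ Algebra.adjoin ℂ s, ∀ z ∈ 𝓛, ampMap K T z ∈ 𝓛 := by
    intro T hT
    induction hT using Algebra.adjoin_induction with
    | mem T hT => exact hs T hT
    | algebraMap c =>
      intro z hz
      rw [Algebra.algebraMap_eq_smul_one, ampMap_smul, ContinuousLinearMap.one_def, ampMap_id]
      exact 𝓛.smul_mem c hz
    | add S T _ _ hS hT =>
      intro z hz
      rw [ampMap_add]
      exact 𝓛.add_mem (hS z hz) (hT z hz)
    | mul S T _ _ hS hT =>
      intro z hz
      rw [ContinuousLinearMap.mul_def, ampMap_comp, ContinuousLinearMap.comp_apply]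
      exact hS _ (hT z hz)
  have hc : Continuous fun T : E →L[ℂ] E => ampMap K T z :=
    ((ContinuousLinearMap.apply ℂ (HilbertTensor E K) z).continuous).comp continuous_ampMap
  exact closure_minimal (t := {T | ampMap K T z ∈ 𝓛}) (fun T hT => hadj T hT z hz)
    (hcl.preimage hc) hT

/-- An operator of the form `P Ψ V`, where `V` and `P` are an isometry and its left inverse,
`Ψ` is an isometry and `P Ψ` vanishes on the kernel of `P`, is a partial isometry if its range is
mapped by `V` into the range of `Ψ`. -/
theorem isPartialIsometry_of_compression {E F E' F' : Type*}
    [NormedAddCommGroup E] [InnerProductSpace ℂ E] [NormedAddCommGroup F] [InnerProductSpace ℂ F]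
    [NormedAddCommGroup E'] [InnerProductSpace ℂ E'] [NormedAddCommGroup F']
    [InnerProductSpace ℂ F'] (Θ : E →L[ℂ] F) (VF : F →ₗᵢ[ℂ] F') (PE : E' →L[ℂ] E)
    (PF : F' →L[ℂ] F) (Ψ : E' →ₗᵢ[ℂ] F')
    (hPE : ‖PE‖ ≤ 1) (hPV : ∀ y, PF (VF y) = y) (hΘ : ∀ z, Θ (PE z) = PF (Ψ z))
    (hrange : ∀ x, ∃ z, Ψ z = VF (Θ x)) (hcontr : ∀ x, ‖Θ x‖ ≤ ‖x‖) :
    IsPartialIsometry Θ := by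
  intro x hx
  obtain ⟨z, hz⟩ := hrange x
  have hx' : Θ (PE z) = Θ x := by rw [hΘ, hz, hPV]
  have hnorm : ‖PE z‖ ≤ ‖Θ x‖ := by
    calc ‖PE z‖ ≤ 1 * ‖z‖ := PE.le_of_opNorm_le hPE z
      _ = ‖Ψ z‖ := by rw [one_mul, Ψ.norm_map]
      _ = ‖Θ x‖ := by rw [hz, VF.norm_map]
  -- `PE z` and `x` have the same image, so their difference lies in the kernel, to which `x` is
  -- orthogonal. Thus `‖x‖² = ⟨PE z, x⟩` and `‖x‖ ≤ ‖PE z‖ ≤ ‖Θ x‖`.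
  have horth : inner ℂ (x - PE z) x = 0 := by
    refine hx _ ?_
    rw [LinearMap.mem_ker, ContinuousLinearMap.coe_coe, map_sub, hx', sub_self]
  rw [inner_sub_left, sub_eq_zero] at horth
  have hsq : ‖x‖ * ‖x‖ ≤ ‖PE z‖ * ‖x‖ := by
    rw [← inner_self_eq_norm_mul_norm (𝕜 := ℂ) x, horth]
    exact (RCLike.re_le_norm _).trans (norm_inner_le_norm _ _)
  refine le_antisymm (hcontr x) ?_
  rcases (norm_nonneg x).eq_or_lt with h0 | h0
  · rw [← h0]; exact norm_nonneg _
  · exact (le_of_mul_le_mul_right hsq h0).trans hnorm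

/-- The Beurling type theorem for the compressions `B_i` of operators `M_i` to a coinvariant
subspace `N` of `ℍ²(f)`, when the `M_i` commute with the right creation operators and generate
the left creation operators. -/
theorem exists_partialIsometry_of_invariant
    {N : Type*} [NormedAddCommGroup N] [InnerProductSpace ℂ N]
    {K : Type v} [NormedAddCommGroup K] [InnerProductSpace ℂ K] [CompleteSpace K]
    {M : Fin n → (H2 n →L[ℂ] H2 n)} {B : Fin n → (N →L[ℂ] N)} {𝒥 : Set (H2 n →L[ℂ] H2 n)}
    (V : N →ₗᵢ[ℂ] H2 n) (P : H2 n →L[ℂ] N)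
    (hP : ‖P‖ ≤ 1) (hPV : P ∘L V.toContinuousLinearMap = ContinuousLinearMap.id ℂ N)
    (hker : ∀ x, P x = 0 →
      x ∈ (Submodule.span ℂ {y | ∃ S ∈ 𝒥, ∃ x, S x = y}).topologicalClosure)
    (hPJ : ∀ S ∈ 𝒥, P ∘L S = 0)
    (hJ : ∀ S ∈ 𝒥, ∀ β, S ∘L rightOp β = rightOp β ∘L S)
    (hM : ∀ i β, M i ∘L rightOp β = rightOp β ∘L M i)
    (hL : ∀ j : Fin n, ∃ T : ℕ → (H2 n →L[ℂ] H2 n),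
      (∀ m, T m ∈ closure (Algebra.adjoin ℂ (Set.range M) : Set (H2 n →L[ℂ] H2 n))) ∧
      ∀ x, Filter.Tendsto (fun m => T m x) Filter.atTop (𝓝 (leftOp [j] x)))
    (hB : ∀ i, B i ∘L P = P ∘L M i)
    {𝓜 : Submodule ℂ (HilbertTensor N K)} (hcl : IsClosed (𝓜 : Set (HilbertTensor N K)))
    (hinv : ∀ i, ∀ x ∈ 𝓜, ampMap K (B i) x ∈ 𝓜) :
    ∃ (G : Type v) (_ : NormedAddCommGroup G) (_ : InnerProductSpace ℂ G) (_ : CompleteSpace G)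
      (Θ : HilbertTensor N G →L[ℂ] HilbertTensor N K),
      IsPartialIsometry (E := HilbertTensor N G) (F := HilbertTensor N K) Θ ∧
      (∀ i, Θ ∘L ampMap G (B i) = ampMap K (B i) ∘L Θ) ∧
      (𝓜 : Set (HilbertTensor N K)) = Set.range Θ := by
  have hBP : ∀ i, ∀ z : HilbertTensor (H2 n) K,
      ampMap K P (ampMap K (M i) z) = ampMap K (B i) (ampMap K P z) := by
    intro i z
    rw [← ContinuousLinearMap.comp_apply, ← ContinuousLinearMap.comp_apply, ← ampMap_comp,
      ← ampMap_comp, hB]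
  -- Taking the full preimage lifts the problem from `N ⊗ K` to `ℍ²(f) ⊗ K`, where the creation
  -- operators act.
  set 𝓛 : Submodule ℂ (HilbertTensor (H2 n) K) := 𝓜.comap (ampMap K P).toLinearMap with h𝓛
  have hmem : ∀ z, z ∈ 𝓛 ↔ ampMap K P z ∈ 𝓜 := fun z => Iff.rfl
  have h𝓛cl : IsClosed (𝓛 : Set (HilbertTensor (H2 n) K)) :=
    hcl.preimage (ampMap K P).continuous
  have h𝓛M : ∀ T ∈ Set.range M, ∀ z ∈ 𝓛, ampMap K T z ∈ 𝓛 := by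
    rintro _ ⟨i, rfl⟩ z hz
    rw [hmem, hBP]
    exact hinv i _ hz
  have h𝓛L : ∀ j, ∀ z ∈ 𝓛, ampMap K (leftOp [j]) z ∈ 𝓛 := by
    intro j z hz
    obtain ⟨T, hT, hlim⟩ := hL j
    exact h𝓛cl.mem_of_tendsto (tendsto_ampMap hlim z)
      (Filter.Eventually.of_forall fun m => ampMap_mem_of_mem_adjoin_closure h𝓛cl h𝓛M (hT m) hz)
  obtain ⟨G, _, _, _, Ψ, hΨ, hrange⟩ := exists_isometry_of_invariant h𝓛L h𝓛cl
  have hcomm : ∀ S : H2 n →L[ℂ] H2 n, (∀ β, S ∘L rightOp β = rightOp β ∘L S) → ∀ z,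
      Ψ (ampMap G S z) = ampMap K S (Ψ z) := fun S hS z =>
    congrArg (fun f => f z) (comp_ampMap_of_commute_rightOp Ψ.toContinuousLinearMap hΨ S hS)
  have hPVK : ∀ y : HilbertTensor N K, ampMap K P (ampIsometry K V y) = y := by
    intro y
    rw [ampIsometry_apply, ← ContinuousLinearMap.comp_apply, ← ampMap_comp, hPV, ampMap_id,
      ContinuousLinearMap.id_apply]
  -- `(P ⊗ I) Ψ` vanishes on `ker P ⊗ G`
  have hvan : ∀ x g, P x = 0 → ampMap K P (Ψ (htmul (H2 n) G x g)) = 0 := by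
    intro x g hx
    set A : H2 n →L[ℂ] HilbertTensor N K :=
      ampMap K P ∘L Ψ.toContinuousLinearMap ∘L (htmul (H2 n) G).flip g with hA
    suffices Submodule.span ℂ {y | ∃ S ∈ 𝒥, ∃ x, S x = y} ≤ LinearMap.ker A.toLinearMap from
      closure_minimal this (isClosed_singleton.preimage A.continuous) (hker x hx)
    refine Submodule.span_le.mpr ?_
    rintro _ ⟨S, hS, x, rfl⟩
    change ampMap K P (Ψ (htmul (H2 n) G (S x) g)) = 0
    rw [← ampMap_htmul, hcomm S (hJ S hS), ← ContinuousLinearMap.comp_apply, ← ampMap_comp,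
      hPJ S hS, ampMap_zero, zero_apply]
  set Θ : HilbertTensor N G →L[ℂ] HilbertTensor N K :=
    ampMap K P ∘L Ψ.toContinuousLinearMap ∘L ampMap G V.toContinuousLinearMap with hΘdef
  have hΘ : ∀ z, Θ (ampMap G P z) = ampMap K P (Ψ z) := by
    intro z
    have : Θ ∘L ampMap G P = ampMap K P ∘L Ψ.toContinuousLinearMap := by
      refine hilbertTensor_ext fun x g => ?_
      -- `V P x` and `x` differ by an element of `ker P`, on which `hvan` applies.
      have h0 : P (V (P x) - x) = 0 := by
        have := congrArg (fun f => f (P x)) hPV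
        rw [map_sub, sub_eq_zero]
        exact this
      have h1 := hvan _ g h0
      rw [map_sub, sub_apply, map_sub, map_sub, sub_eq_zero] at h1
      rw [ContinuousLinearMap.comp_apply, ampMap_htmul, hΘdef, ContinuousLinearMap.comp_apply,
        ContinuousLinearMap.comp_apply, ampMap_htmul]
      exact h1
    exact congrArg (fun f => f z) this
  have hΘmem : ∀ x, Θ x ∈ 𝓜 := by
    intro x
    have : Ψ (ampMap G V.toContinuousLinearMap x) ∈ (𝓛 : Set _) := by
      rw [← hrange]; exact ⟨_, rfl⟩
    exact this
  have hlift : ∀ y ∈ 𝓜, ∃ z, Ψ z = ampIsometry K V y := by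
    intro y hy
    have : ampIsometry K V y ∈ (𝓛 : Set _) := by
      rw [SetLike.mem_coe, hmem, hPVK]; exact hy
    rwa [← hrange] at this
  have hΘV : ∀ x, Θ x = ampMap K P (Ψ (ampIsometry G V x)) := fun x => rfl
  clear_value Θ
  refine ⟨G, _, _, ‹_›, Θ, ?_, fun i => ?_, ?_⟩
  · refine isPartialIsometry_of_compression Θ (ampIsometry K V) (ampMap G P) (ampMap K P) Ψ
      ((norm_ampMap_le P).trans hP) hPVK hΘ (fun x => hlift _ (hΘmem x)) fun x => ?_
    rw [hΘV]
    calc _ ≤ 1 * ‖Ψ (ampIsometry G V x)‖ :=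
          (ampMap K P).le_of_opNorm_le ((norm_ampMap_le P).trans hP) _
      _ = ‖x‖ := by rw [one_mul, Ψ.norm_map, (ampIsometry G V).norm_map]
  · have hBV : B i = P ∘L M i ∘L V.toContinuousLinearMap := by
      rw [← ContinuousLinearMap.comp_assoc, ← hB, ContinuousLinearMap.comp_assoc, hPV,
        ContinuousLinearMap.comp_id]
    ext1 x
    rw [ContinuousLinearMap.comp_apply, ContinuousLinearMap.comp_apply]
    -- With ampliations suppressed: `Θ B_i = Θ P M_i V = P Ψ M_i V = P M_i Ψ V = B_i P Ψ V = B_i Θ`.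
    conv_lhs => rw [hBV, ampMap_comp, ContinuousLinearMap.comp_apply, hΘ, ampMap_comp,
      ContinuousLinearMap.comp_apply, hcomm _ (hM i), hBP]
    rw [hΘV, ampIsometry_apply]
  · ext y
    constructor
    · intro hy
      obtain ⟨z, hz⟩ := hlift y hy
      exact ⟨ampMap G P z, by rw [hΘ, hz, hPVK]⟩
    · rintro ⟨x, rfl⟩
      exact hΘmem x

end Compression

/-! ### The Hardy algebra of operators commuting with the right creation operators -/

section Hardy

variable {n : ℕ}

/-- The commutant of an operator is closed in the weak operator topology. -/
theorem commute_of_mem_wotClosure {E : Type*} [NormedAddCommGroup E] [InnerProductSpace ℂ E]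
    {s : Set (E →L[ℂ] E)} {R : E →L[ℂ] E}
    (hs : ∀ T ∈ s, T ∘L R = R ∘L T) {T : E →L[ℂ] E} (hT : T ∈ wotClosure s) :
    T ∘L R = R ∘L T := by
  have hc : IsClosed {A : E →WOT[ℂ] E |
      A.comp (ContinuousLinearMapWOT.ofCLM R) = (ContinuousLinearMapWOT.ofCLM R).comp A} :=
    isClosed_eq (ContinuousLinearMapWOT.continuous_precomp _)
      (ContinuousLinearMapWOT.continuous_postcomp _)
  have h : ContinuousLinearMapWOT.ofCLM '' s ⊆ {A : E →WOT[ℂ] E |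
      A.comp (ContinuousLinearMapWOT.ofCLM R) = (ContinuousLinearMapWOT.ofCLM R).comp A} := by
    rintro _ ⟨A, hA, rfl⟩
    exact congrArg ContinuousLinearMapWOT.ofCLM (hs A hA)
  exact congrArg ContinuousLinearMapWOT.toCLM (closure_minimal h hc hT)

theorem commute_of_mem_hardyAlgebra {M : Fin n → (H2 n →L[ℂ] H2 n)} {R : H2 n →L[ℂ] H2 n}
    (hM : ∀ i, M i ∘L R = R ∘L M i) {S : H2 n →L[ℂ] H2 n} (hS : S ∈ hardyAlgebra M) :
    S ∘L R = R ∘L S := by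
  refine commute_of_mem_wotClosure (fun T hT => ?_) hS
  have hle : Algebra.adjoin ℂ (Set.range M) ≤ Subalgebra.centralizer ℂ {R} := by
    refine Algebra.adjoin_le ?_
    rintro _ ⟨i, rfl⟩
    rw [SetLike.mem_coe, Subalgebra.mem_centralizer_iff]
    rintro _ rfl
    exact (hM i).symm
  exact ((Subalgebra.mem_centralizer_iff ℂ).mp (hle hT) R rfl).symm

theorem mem_hardyAlgebra (M : Fin n → (H2 n →L[ℂ] H2 n)) (i : Fin n) : M i ∈ hardyAlgebra M :=
  subset_closure ⟨M i, Algebra.subset_adjoin ⟨i, rfl⟩, rfl⟩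

/-- The closed span of `J ℍ²(f)`. -/
def idealRange (J : Submodule ℂ (H2 n →L[ℂ] H2 n)) : Submodule ℂ (H2 n) :=
  (Submodule.span ℂ {y : H2 n | ∃ T ∈ J, ∃ x : H2 n, T x = y}).topologicalClosure

theorem isClosed_idealRange (J : Submodule ℂ (H2 n →L[ℂ] H2 n)) :
    IsClosed (idealRange J : Set (H2 n)) := Submodule.isClosed_topologicalClosure _

theorem apply_mem_idealRange {J : Submodule ℂ (H2 n →L[ℂ] H2 n)} {T : H2 n →L[ℂ] H2 n}
    (hT : T ∈ J) (x : H2 n) : T x ∈ idealRange J :=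
  Submodule.le_topologicalClosure _ (Submodule.subset_span ⟨T, hT, x, rfl⟩)

theorem projection_varietySpace_eq_zero_iff (J : Submodule ℂ (H2 n →L[ℂ] H2 n)) (x : H2 n) :
    (varietySpace J).orthogonalProjectionOnto x = 0 ↔ x ∈ idealRange J := by
  have : CompleteSpace (idealRange J) := (isClosed_idealRange J).completeSpace_coe
  have h : (varietySpace J)ᗮ = idealRange J := (idealRange J).orthogonal_orthogonal
  rw [Submodule.orthogonalProjectionOnto_eq_zero_iff, h]

/-- The range of a left ideal is invariant. -/
theorem mem_idealRange_of_mul_left {J : Submodule ℂ (H2 n →L[ℂ] H2 n)} {S : H2 n →L[ℂ] H2 n}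
    (hS : ∀ T ∈ J, S * T ∈ J) {x : H2 n} (hx : x ∈ idealRange J) : S x ∈ idealRange J := by
  suffices idealRange J ≤ (idealRange J).comap S.toLinearMap from this hx
  refine Submodule.topologicalClosure_minimal _ (Submodule.span_le.mpr ?_)
    ((isClosed_idealRange J).preimage S.continuous)
  rintro _ ⟨T, hT, x, rfl⟩
  exact apply_mem_idealRange (hS T hT) x

/-- `ker P` is the closed range of the ideal, which `M_i` preserves. Hence `P M_i` does not see the
difference between `x` and `P x`. -/
theorem universalModel_comp_projection {M : Fin n → (H2 n →L[ℂ] H2 n)}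
    {J : Submodule ℂ (H2 n →L[ℂ] H2 n)} (hJ : IsWOTClosedIdeal (hardyAlgebra M) J) (i : Fin n) :
    universalModel M J i ∘L (varietySpace J).orthogonalProjectionOnto =
      (varietySpace J).orthogonalProjectionOnto ∘L M i := by
  ext1 x
  change (varietySpace J).orthogonalProjectionOnto
    (M i ((varietySpace J).orthogonalProjectionOnto x : H2 n)) =
    (varietySpace J).orthogonalProjectionOnto (M i x)
  rw [← sub_eq_zero, ← map_sub, ← map_sub, projection_varietySpace_eq_zero_iff]
  refine mem_idealRange_of_mul_left (hJ.mul_left _ (mem_hardyAlgebra M i)) ?_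
  rw [← projection_varietySpace_eq_zero_iff, map_sub,
    Submodule.orthogonalProjectionOnto_mem_subspace_eq_self, sub_self]

/-- The properties of the multiplication operators on which the Beurling type theorem rests. -/
theorem exists_partialIsometry_varietySpace {M : Fin n → (H2 n →L[ℂ] H2 n)}
    (hM : ∀ i β, M i ∘L rightOp β = rightOp β ∘L M i)
    (hL : ∀ j : Fin n, ∃ T : ℕ → (H2 n →L[ℂ] H2 n),
      (∀ m, T m ∈ closure (Algebra.adjoin ℂ (Set.range M) : Set (H2 n →L[ℂ] H2 n))) ∧
      ∀ x, Filter.Tendsto (fun m => T m x) Filter.atTop (𝓝 (leftOp [j] x)))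
    {J : Submodule ℂ (H2 n →L[ℂ] H2 n)} (hJ : IsWOTClosedIdeal (hardyAlgebra M) J)
    {K : Type v} [NormedAddCommGroup K] [InnerProductSpace ℂ K] [CompleteSpace K]
    {𝓜 : Submodule ℂ (HilbertTensor (varietySpace J) K)}
    (hcl : IsClosed (𝓜 : Set (HilbertTensor (varietySpace J) K)))
    (hinv : ∀ i, ∀ x ∈ 𝓜, ampMap K (universalModel M J i) x ∈ 𝓜) :
    ∃ (G : Type v) (_ : NormedAddCommGroup G) (_ : InnerProductSpace ℂ G) (_ : CompleteSpace G)
      (Θ : HilbertTensor (varietySpace J) G →L[ℂ] HilbertTensor (varietySpace J) K),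
      IsPartialIsometry (E := HilbertTensor (varietySpace J) G)
        (F := HilbertTensor (varietySpace J) K) Θ ∧
      (∀ i, Θ ∘L ampMap G (universalModel M J i) = ampMap K (universalModel M J i) ∘L Θ) ∧
      (𝓜 : Set (HilbertTensor (varietySpace J) K)) = Set.range Θ := by
  have hker : ∀ x, (varietySpace J).orthogonalProjectionOnto x = 0 →
      x ∈ (Submodule.span ℂ {y | ∃ S ∈ (J : Set (H2 n →L[ℂ] H2 n)), ∃ x, S x = y} :
        Submodule ℂ (H2 n)).topologicalClosure := by
    intro x hx
    exact (projection_varietySpace_eq_zero_iff J x).mp hx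
  have hPV : (varietySpace J).orthogonalProjectionOnto ∘L
      (varietySpace J).subtypeₗᵢ.toContinuousLinearMap =
        ContinuousLinearMap.id ℂ (varietySpace J) := by
    ext1 x
    exact Submodule.orthogonalProjectionOnto_mem_subspace_eq_self x
  have hPJ : ∀ S ∈ (J : Set (H2 n →L[ℂ] H2 n)),
      (varietySpace J).orthogonalProjectionOnto ∘L S = 0 := by
    intro S hS
    ext1 x
    exact (projection_varietySpace_eq_zero_iff J _).mpr (apply_mem_idealRange hS x)
  exact exists_partialIsometry_of_invariant (varietySpace J).subtypeₗᵢ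
    (varietySpace J).orthogonalProjectionOnto (Submodule.orthogonalProjectionOnto_norm_le _)
    hPV hker hPJ
    (fun S hS β => commute_of_mem_hardyAlgebra (fun i => hM i β) (hJ.subset hS)) hM hL
    (universalModel_comp_projection hJ) hcl hinv

end Hardy

/-! ### Left multiplications -/

section LeftMultiplication

variable {n : ℕ}

theorem rightOp_append (α β : List (Fin n)) : rightOp (α ++ β) = rightOp β ∘L rightOp α :=
  clm_ext_wordBasis fun γ => by simp

variable {A : Type*} [Mul A] {Rep : H2 n → A → Prop} {w : List (Fin n) → A}

/-- Left multiplications commute with the right creation operators. -/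
theorem IsLeftMultiplication.comp_rightOp (hbasis : ∀ α, Rep (wordBasis n α) (w α))
    (hright : ∀ a F α, Rep a F → Rep (rightOp α a) (F * w α))
    (huniq : ∀ a b F, Rep a F → Rep b F → a = b)
    (hone : ∀ u α, u * w [] * w α = u * w α) {u : A} {T : H2 n →L[ℂ] H2 n}
    (hT : IsLeftMultiplication Rep u T) (β : List (Fin n)) :
    T ∘L rightOp β = rightOp β ∘L T := by
  -- Both sides represent `u f_α`, so `T` is determined by its value at the empty word. Commutation
  -- then follows from `R_{αβ} = R_β R_α`.
  have h : ∀ α, T (wordBasis n α) = rightOp α (T (wordBasis n [])) := by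
    intro α
    refine huniq _ _ (u * w α) (hT _ _ (hbasis α)) ?_
    rw [← hone]
    exact hright _ _ _ (hT _ _ (hbasis []))
  refine clm_ext_wordBasis fun α => ?_
  rw [ContinuousLinearMap.comp_apply, ContinuousLinearMap.comp_apply, rightOp_wordBasis, h, h α,
    rightOp_append, ContinuousLinearMap.comp_apply]

/-- By uniqueness of coordinates, `f_j f_α = f_{jα}` forces the action on the basis. It is applied
with `u = f_j`. -/
theorem IsLeftMultiplication.eq_leftOp (hbasis : ∀ α, Rep (wordBasis n α) (w α))
    (huniq : ∀ a b F, Rep a F → Rep b F → a = b) {u : A} {T : H2 n →L[ℂ] H2 n}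
    (hT : IsLeftMultiplication Rep u T) {j : Fin n} (hu : ∀ α, u * w α = w (j :: α)) :
    T = leftOp [j] := by
  refine clm_ext_wordBasis fun α => ?_
  rw [leftOp_wordBasis]
  refine huniq _ _ (u * w α) (hT _ _ (hbasis α)) ?_
  rw [hu]
  exact hbasis _

end LeftMultiplication

/-! ### Limits of polynomials -/

section Evaluation

variable {n : ℕ} {H : Type*} [NormedAddCommGroup H] [InnerProductSpace ℂ H]

theorem wordProd_mem {R : Type*} [Semiring R] [Algebra ℂ R] (B : Subalgebra ℂ R) {x : Fin n → R}
    (hx : ∀ i, x i ∈ B) (α : List (Fin n)) : wordProd x α ∈ B := by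
  refine B.list_prod_mem fun y hy => ?_
  obtain ⟨i, -, rfl⟩ := List.mem_map.mp hy
  exact hx i

theorem partialEval_mem (B : Subalgebra ℂ (H →L[ℂ] H)) {X : Fin n → (H →L[ℂ] H)}
    (hX : ∀ i, X i ∈ B) (a : List (Fin n) → ℂ) (m : ℕ) : partialEval a X m ∈ B :=
  B.sum_mem fun _ _ => B.sum_mem fun _ _ => B.smul_mem (wordProd_mem B hX _) _

/-- If `f_j(M_1, …, M_n)` is the left creation operator, then it is the strong limit of a sequence
in the norm closure of the algebra generated by `M_1, …, M_n`. -/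
theorem EvaluatesTo.exists_seq {f : Fin n → NCSeries n} {M Mf : Fin n → (H2 n →L[ℂ] H2 n)}
    (h : EvaluatesTo f M Mf) (j : Fin n) : ∃ T : ℕ → (H2 n →L[ℂ] H2 n),
      (∀ m, T m ∈ closure (Algebra.adjoin ℂ (Set.range M) : Set (H2 n →L[ℂ] H2 n))) ∧
      ∀ x, Filter.Tendsto (fun m => T m x) Filter.atTop (𝓝 (Mf j x)) := by
  have hM : ∀ i, M i ∈ Algebra.adjoin ℂ (Set.range M) := fun i => Algebra.subset_adjoin ⟨i, rfl⟩
  rcases h with h | h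
  · exact ⟨partialEval (f j) M, fun m => subset_closure (partialEval_mem _ hM _ m), h j⟩
  · obtain ⟨δ, hδ, V, hV, hlim⟩ := h j
    -- The radial limit is sampled along a sequence `r_m → 1`, since `tendsto_ampMap` is about
    -- sequences. Each value at `r_m` is only a norm limit of polynomials, hence the norm closure in
    -- the conclusion.
    obtain ⟨r, -, hr, hr1⟩ := exists_seq_strictMono_tendsto' hδ.2
    refine ⟨fun m => V (r m), fun m => ?_, fun x => (hlim x).comp ?_⟩
    · exact mem_closure_of_tendsto (hV _ (hr m)) (Filter.Eventually.of_forall fun k =>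
        partialEval_mem _ (fun i => Subalgebra.smul_mem _ (hM i) _) _ k)
    · exact tendsto_nhdsWithin_iff.mpr ⟨hr1, Filter.Eventually.of_forall fun m => (hr m).2⟩

end Evaluation

/-! ### Tuples of polynomials -/

section Polynomials

variable {n : ℕ}

theorem wordProd_append {R : Type*} [Monoid R] (x : Fin n → R) (α β : List (Fin n)) :
    wordProd x (α ++ β) = wordProd x α * wordProd x β := by
  simp [wordProd]

theorem wordProd_cons {R : Type*} [Mul R] [One R] (x : Fin n → R) (j : Fin n)
    (α : List (Fin n)) : wordProd x (j :: α) = x j * wordProd x α := by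
  simp [wordProd]

theorem map_wordProd {R S G : Type*} [Semiring R] [Semiring S] [FunLike G R S]
    [RingHomClass G R S] (g : G) (x : Fin n → R) (α : List (Fin n)) :
    g (wordProd x α) = wordProd (fun i => g (x i)) α := by
  simp [wordProd, map_list_prod, Function.comp_def]

theorem polyEval_eq_linearCombination {R : Type*} [Semiring R] [Algebra ℂ R] (x : Fin n → R)
    (s : List (Fin n) →₀ ℂ) : polyEval x s = Finsupp.linearCombination ℂ (wordProd x) s := rfl

theorem map_polyEval {R S : Type*} [Semiring R] [Algebra ℂ R] [Semiring S] [Algebra ℂ S]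
    (g : R →ₐ[ℂ] S) (x : Fin n → R) (s : List (Fin n) →₀ ℂ) :
    g (polyEval x s) = polyEval (fun i => g (x i)) s := by
  simp only [polyEval, Finsupp.sum, map_sum, map_smul, map_wordProd]

theorem polyEval_mem {R : Type*} [Semiring R] [Algebra ℂ R] (B : Subalgebra ℂ R) {x : Fin n → R}
    (hx : ∀ i, x i ∈ B) (s : List (Fin n) →₀ ℂ) : polyEval x s ∈ B :=
  B.sum_mem fun _ _ => B.smul_mem (wordProd_mem B hx _) _

theorem wordProd_leftOp (α : List (Fin n)) : wordProd (fun i => leftOp [i]) α = leftOp α := by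
  induction α with
  | nil => exact leftOp_nil.symm
  | cons j α ih =>
    rw [wordProd_cons, ih, show j :: α = [j] ++ α from rfl, leftOp_append]
    rfl

/-- Representing the indeterminates by the `L_i` and applying the result to `f_∅` recovers all
coefficients of a polynomial. -/
theorem polyEval_ι_injective :
    Function.Injective (polyEval (FreeAlgebra.ι ℂ : Fin n → FreeAlgebra ℂ (Fin n))) := by
  have key : ∀ s : List (Fin n) →₀ ℂ, ∀ α : List (Fin n),
      FreeAlgebra.lift ℂ (fun i => leftOp [i]) (polyEval (FreeAlgebra.ι ℂ) s)
        (wordBasis n []) α = s α := by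
    intro s α
    rw [map_polyEval, polyEval, Finsupp.sum, sum_apply, lp.coeFn_sum, Finset.sum_apply]
    simp only [FreeAlgebra.lift_ι_apply, wordProd_leftOp, smul_apply, leftOp_wordBasis,
      List.append_nil, lp.coeFn_smul, Pi.smul_apply, wordBasis_apply, smul_eq_mul, mul_ite, mul_one,
      mul_zero, Finset.sum_ite_eq, Finsupp.mem_support_iff, ite_not]
    split_ifs with h
    · exact h.symm
    · rfl
  intro s t h
  ext α
  rw [← key s, ← key t, h]

variable {p : Fin n → FreeAlgebra ℂ (Fin n)}

theorem repPoly_wordBasis (α : List (Fin n)) : RepPoly p (wordBasis n α) (wordProd p α) := by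
  refine ⟨Finsupp.single α 1, fun β => ?_, ?_⟩
  · rw [wordBasis_apply, Finsupp.single_apply]
    simp only [eq_comm]
  · simp [polyEval]

theorem RepPoly.rightOp {a : H2 n} {F : FreeAlgebra ℂ (Fin n)} (h : RepPoly p a F)
    (α : List (Fin n)) : RepPoly p (rightOp α a) (F * wordProd p α) := by
  obtain ⟨s, hs, rfl⟩ := h
  refine ⟨s.mapDomain (fun β => β ++ α), fun δ => ?_, ?_⟩
  · by_cases hδ : α <:+ δ
    · obtain ⟨γ, rfl⟩ := hδ
      rw [rightOp_apply_append, hs, Finsupp.mapDomain_apply (List.append_left_injective α)]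
    · rw [rightOp_apply_eq_zero _ hδ, Finsupp.mapDomain_of_notMem_range]
      rintro ⟨γ, rfl⟩
      exact hδ (List.suffix_append γ α)
  · rw [polyEval, polyEval, Finsupp.sum_mapDomain_index (by simp) (by simp [add_smul]),
      Finsupp.sum_mul]
    simp only [wordProd_append, smul_mul_assoc]

/-- Substituting `q` turns `∑ a_α p_α` into `∑ a_α Z_α`, from which the coefficients can be read. -/
theorem RepPoly.unique {q : Fin n → FreeAlgebra ℂ (Fin n)}
    (hq : ∀ i, FreeAlgebra.lift ℂ q (p i) = FreeAlgebra.ι ℂ i)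
    {a b : H2 n} {F : FreeAlgebra ℂ (Fin n)} (ha : RepPoly p a F) (hb : RepPoly p b F) :
    a = b := by
  obtain ⟨s, hs, rfl⟩ := ha
  obtain ⟨t, ht, h⟩ := hb
  have h' := congrArg (FreeAlgebra.lift ℂ q) h
  rw [map_polyEval, map_polyEval] at h'
  simp only [hq] at h'
  have hst : s = t := polyEval_ι_injective h'
  exact lp.ext (funext fun α => by rw [hs, ht, hst])

theorem RepPoly.add {a b : H2 n} {F G : FreeAlgebra ℂ (Fin n)} (ha : RepPoly p a F)
    (hb : RepPoly p b G) : RepPoly p (a + b) (F + G) := by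
  obtain ⟨s, hs, rfl⟩ := ha
  obtain ⟨t, ht, rfl⟩ := hb
  refine ⟨s + t, fun α => ?_, ?_⟩
  · rw [lp.coeFn_add, Pi.add_apply, hs, ht, Finsupp.add_apply]
  · simp only [polyEval_eq_linearCombination, map_add]

theorem RepPoly.smul {a : H2 n} {F : FreeAlgebra ℂ (Fin n)} (c : ℂ) (ha : RepPoly p a F) :
    RepPoly p (c • a) (c • F) := by
  obtain ⟨s, hs, rfl⟩ := ha
  refine ⟨c • s, fun α => ?_, ?_⟩
  · rw [lp.coeFn_smul, Pi.smul_apply, hs, Finsupp.smul_apply]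
  · simp only [polyEval_eq_linearCombination, map_smul]

theorem isLeftMultiplication_lift {M : Fin n → (H2 n →L[ℂ] H2 n)}
    (hM : ∀ i, IsLeftMultiplication (RepPoly p) (FreeAlgebra.ι ℂ i) (M i))
    (Q : FreeAlgebra ℂ (Fin n)) :
    IsLeftMultiplication (RepPoly p) Q (FreeAlgebra.lift ℂ M Q) := by
  induction Q using FreeAlgebra.induction with
  | grade0 c =>
    intro a F h
    rw [AlgHom.commutes, Algebra.algebraMap_eq_smul_one, Algebra.algebraMap_eq_smul_one,
      smul_one_mul]
    exact h.smul c
  | grade1 i => rw [FreeAlgebra.lift_ι_apply]; exact hM i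
  | mul P Q hP hQ =>
    intro a F h
    rw [map_mul, mul_assoc]
    exact hP _ _ (hQ _ _ h)
  | add P Q hP hQ =>
    intro a F h
    rw [map_add, add_mul]
    exact (hP _ _ h).add (hQ _ _ h)

theorem PropertyA.comp_rightOp {f : Fin n → NCSeries n} {M : Fin n → (H2 n →L[ℂ] H2 n)}
    (h : PropertyA f M) (i : Fin n) (β : List (Fin n)) :
    M i ∘L NCVariety.rightOp β = NCVariety.rightOp β ∘L M i := by
  obtain ⟨p, q, -, hq, -, hM⟩ := h
  exact (hM i).comp_rightOp repPoly_wordBasis (fun _ _ α h => h.rightOp α)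
    (fun _ _ _ ha hb => ha.unique hq hb) (fun u α => by simp [wordProd]) β

theorem PropertyA.exists_seq {f : Fin n → NCSeries n} {M : Fin n → (H2 n →L[ℂ] H2 n)}
    (h : PropertyA f M) (j : Fin n) : ∃ T : ℕ → (H2 n →L[ℂ] H2 n),
      (∀ m, T m ∈ closure (Algebra.adjoin ℂ (Set.range M) : Set (H2 n →L[ℂ] H2 n))) ∧
      ∀ x, Filter.Tendsto (fun m => T m x) Filter.atTop (𝓝 (leftOp [j] x)) := by
  obtain ⟨p, q, hp, hq, -, hM⟩ := h
  obtain ⟨s, -, hs⟩ := hp j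
  have hL : FreeAlgebra.lift ℂ M (p j) = leftOp [j] :=
    (isLeftMultiplication_lift hM (p j)).eq_leftOp repPoly_wordBasis
      (fun _ _ _ ha hb => ha.unique hq hb) fun α => (wordProd_cons p j α).symm
  refine ⟨fun _ => FreeAlgebra.lift ℂ M (p j), fun _ => subset_closure ?_, fun x => ?_⟩
  · rw [hs, map_polyEval]
    simp only [FreeAlgebra.lift_ι_apply]
    exact polyEval_mem _ (fun i => Algebra.subset_adjoin (Set.mem_range_self i)) s
  · rw [hL]
    exact tendsto_const_nhds

end Polynomials

/-! ### Sums over words -/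

section Words

variable {n : ℕ}

/-- The finite set of words of length less than `m`. -/
def wordsLT (n m : ℕ) : Finset (List (Fin n)) := (List.finite_length_lt (Fin n) m).toFinset

@[simp]
theorem mem_wordsLT {m : ℕ} {α : List (Fin n)} : α ∈ wordsLT n m ↔ α.length < m := by
  simp [wordsLT]

theorem sum_range_ofFn {X : Type*} [AddCommMonoid X] (g : List (Fin n) → X) (m : ℕ) :
    ∑ k ∈ Finset.range m, ∑ w : Fin k → Fin n, g (List.ofFn w) = ∑ α ∈ wordsLT n m, g α := by
  rw [Finset.sum_sigma']
  refine Finset.sum_bij' (fun x _ => List.ofFn x.2) (fun α _ => ⟨α.length, α.get⟩) ?_ ?_ ?_ ?_ ?_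
  · rintro ⟨k, w⟩ h
    simpa using h
  · intro α h
    simpa using h
  · rintro ⟨k, w⟩ _
    exact List.equivSigmaTuple.apply_symm_apply ⟨k, w⟩
  · intro α _
    exact List.ofFn_get α
  · intro _ _
    rfl

/-- A sum over words, of a function supported on the words which end with `α`. -/
theorem sum_wordsLT_append {X : Type*} [AddCommMonoid X] (g : List (Fin n) → X)
    (α : List (Fin n)) (hg : ∀ δ, ¬ α <:+ δ → g δ = 0) (m : ℕ) :
    ∑ δ ∈ wordsLT n (m + α.length), g δ = ∑ γ ∈ wordsLT n m, g (γ ++ α) := by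
  symm
  refine Finset.sum_of_injOn (fun γ => γ ++ α) (List.append_left_injective α).injOn ?_ ?_ ?_
  · intro γ hγ
    simpa using hγ
  · intro δ hδ hδ'
    refine hg δ ?_
    rintro ⟨γ, rfl⟩
    exact hδ' ⟨γ, by simpa using hδ, rfl⟩
  · intro _ _
    rfl

theorem partialEval_eq_sum {H : Type*} [NormedAddCommGroup H] [InnerProductSpace ℂ H]
    (a : List (Fin n) → ℂ) (X : Fin n → (H →L[ℂ] H))
    (m : ℕ) :
    partialEval a X m = ∑ α ∈ wordsLT n m, a α • wordProd X α :=
  sum_range_ofFn (fun α => a α • wordProd X α) m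

end Words

/-! ### The algebra of formal power series -/

namespace NCSeries

variable {n : ℕ}

theorem mul_apply (F G : NCSeries n) (β : List (Fin n)) :
    (F * G) β = ∑ k ∈ Finset.range (β.length + 1), F (β.take k) * G (β.drop k) := rfl

theorem one_apply (β : List (Fin n)) : (1 : NCSeries n) β = if β = [] then 1 else 0 := rfl

/-- The series obtained from `F` by deleting the first letter `i`. -/
def tail (i : Fin n) (F : NCSeries n) : NCSeries n := fun γ => F (i :: γ)

theorem mul_nil (F G : NCSeries n) : (F * G) [] = F [] * G [] := by
  simp [mul_apply]

/-- The factorization with empty first factor is split off. This recursion reduces associativity to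
an induction on the word. -/
theorem mul_cons (F G : NCSeries n) (i : Fin n) (β : List (Fin n)) :
    (F * G) (i :: β) = F [] * G (i :: β) + (tail i F * G) β := by
  rw [mul_apply, List.length_cons, Finset.sum_range_succ', add_comm]
  rfl

protected theorem mul_assoc (F G E : NCSeries n) : F * G * E = F * (G * E) := by
  have h : ∀ (c : ℂ) (G F E : NCSeries n) (β : List (Fin n)),
      ((show NCSeries n from fun γ => c * G γ + F γ) * E) β = c * (G * E) β + (F * E) β := by
    intro c G F E β
    simp only [mul_apply, Finset.mul_sum, ← Finset.sum_add_distrib]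
    exact Finset.sum_congr rfl fun k _ => by ring
  funext β
  induction β generalizing F with
  | nil => simp only [mul_nil, mul_assoc]
  | cons i β ih =>
    rw [mul_cons, mul_cons, mul_nil, mul_cons, ← ih]
    have ht : tail i (F * G) = (show NCSeries n from fun γ => F [] * tail i G γ + (tail i F * G) γ) :=
      funext fun γ => mul_cons F G i γ
    rw [ht, h]
    ring

protected theorem mul_one (F : NCSeries n) : F * 1 = F := by
  funext β
  rw [mul_apply, Finset.sum_range_succ, Finset.sum_eq_zero]
  · simp [one_apply]
  · intro k hk
    rw [one_apply, if_neg, mul_zero]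
    simpa [List.drop_eq_nil_iff] using hk

protected theorem one_mul (F : NCSeries n) : 1 * F = F := by
  funext β
  rw [mul_apply, Finset.sum_range_succ', Finset.sum_eq_zero]
  · simp [one_apply]
  · intro k hk
    rw [one_apply, if_neg, zero_mul]
    cases β with
    | nil => simp at hk
    | cons i β => simp

instance : Monoid (NCSeries n) where
  mul_assoc := NCSeries.mul_assoc
  one_mul := NCSeries.one_mul
  mul_one := NCSeries.mul_one

variable {f : Fin n → NCSeries n}

theorem wordProd_apply_eq_zero (hf : ∀ i, f i [] = 0) {α δ : List (Fin n)}
    (h : δ.length < α.length) : wordProd f α δ = 0 := by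
  induction α generalizing δ with
  | nil => simp at h
  | cons j α ih =>
    rw [wordProd_cons, mul_apply]
    refine Finset.sum_eq_zero fun k hk => ?_
    rcases Nat.eq_zero_or_pos k with rfl | hk0
    · rw [List.take_zero, hf, zero_mul]
    · rw [ih, mul_zero]
      simp only [Finset.mem_range, List.length_cons] at hk h
      rw [List.length_drop]
      omega

theorem wordProd_ofFn_apply_ofFn (hf : ∀ i, f i [] = 0) {k : ℕ} (w d : Fin k → Fin n) :
    wordProd f (List.ofFn w) (List.ofFn d) = ∏ i, f (w i) [d i] := by
  induction k with
  | zero => simp [wordProd, one_apply]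
  | succ k ih =>
    -- The first factor has to take exactly one letter: none is excluded by `f(0) = 0`, and more
    -- would leave fewer letters than remaining factors.
    rw [List.ofFn_succ, wordProd_cons, mul_apply, Finset.sum_eq_single 1, Fin.prod_univ_succ,
      ← ih, List.ofFn_succ]
    · rfl
    · intro b hb hb1
      rcases Nat.eq_zero_or_pos b with rfl | hb0
      · rw [List.take_zero, hf, zero_mul]
      · rw [wordProd_apply_eq_zero hf, mul_zero]
        simp only [Finset.mem_range, List.length_ofFn] at hb
        rw [List.length_drop, List.length_ofFn, List.length_ofFn]
        omega
    · intro h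
      simp at h

theorem formalComp_apply (hf : ∀ i, f i [] = 0) (a : List (Fin n) → ℂ) (δ : List (Fin n)) {m : ℕ}
    (hm : δ.length < m) : formalComp a f δ = ∑ α ∈ wordsLT n m, a α * wordProd f α δ := by
  rw [formalComp, sum_range_ofFn (fun α => a α * wordProd f α δ)]
  refine Finset.sum_subset (fun α hα => ?_) fun α _ hα => ?_
  · rw [mem_wordsLT] at hα ⊢
    omega
  · rw [wordProd_apply_eq_zero hf, mul_zero]
    rw [mem_wordsLT] at hα
    omega

theorem formalComp_wordBasis (hf : ∀ i, f i [] = 0) (α : List (Fin n)) :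
    formalComp (fun β => wordBasis n α β) f = wordProd f α := by
  funext δ
  rw [formalComp_apply hf _ δ (m := δ.length + α.length + 1) (by omega),
    Finset.sum_eq_single α]
  · simp [wordBasis_apply]
  · intro β _ hβ
    simp [wordBasis_apply, hβ]
  · intro h
    rw [mem_wordsLT] at h
    omega

theorem formalComp_rightOp (hf : ∀ i, f i [] = 0) (a : H2 n) (α : List (Fin n)) :
    formalComp (fun β => rightOp α a β) f = formalComp (fun β => a β) f * wordProd f α := by
  funext δ
  -- Removing the suffix `α` from words below this cutoff leaves words of length at most `|δ|`,
  -- which suffices for every prefix of `δ`.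
  rw [formalComp_apply hf _ δ (m := δ.length + 1 + α.length) (by omega),
    sum_wordsLT_append (fun β => rightOp α a β * wordProd f β δ) α, mul_apply]
  · simp only [rightOp_apply_append, wordProd_append, mul_apply]
    simp only [Finset.mul_sum]
    rw [Finset.sum_comm]
    refine Finset.sum_congr rfl fun k hk => ?_
    rw [formalComp_apply hf _ (δ.take k) (m := δ.length + 1), Finset.sum_mul]
    · exact Finset.sum_congr rfl fun γ _ => by ring
    · rw [List.length_take]
      omega
  · intro β hβ
    rw [rightOp_apply_eq_zero _ hβ, zero_mul]

theorem formalComp_sub (a b : List (Fin n) → ℂ) (δ : List (Fin n)) :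
    formalComp (fun α => a α - b α) f δ = formalComp a f δ - formalComp b f δ := by
  simp only [formalComp, sub_mul, Finset.sum_sub_distrib]

/-- The series `f_α` are linearly independent if the Jacobian of `f` at `0` is invertible. -/
theorem eq_zero_of_formalComp_eq_zero (hf : ∀ i, f i [] = 0) (hdet : (jacobianZero f).det ≠ 0)
    {c : List (Fin n) → ℂ} (hc : ∀ δ, formalComp c f δ = 0) (α : List (Fin n)) : c α = 0 := by
  induction hk : α.length using Nat.strong_induction_on generalizing α with
  | _ k ih =>
    -- In degree `k`, shorter words drop out by induction. What remains is the `k`-th tensor power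
    -- of the Jacobian applied to the coefficients of degree `k`, and `hprod` inverts it by the
    -- tensor power of the inverse.
    have hcoef : ∀ d : Fin k → Fin n,
        ∑ w : Fin k → Fin n, c (List.ofFn w) * ∏ i, jacobianZero f (w i) (d i) = 0 := by
      intro d
      have h := hc (List.ofFn d)
      rw [formalComp, List.length_ofFn, Finset.sum_range_succ, Finset.sum_eq_zero, zero_add] at h
      · simp only [wordProd_ofFn_apply_ofFn hf] at h
        exact h
      · intro l hl
        refine Finset.sum_eq_zero fun w _ => ?_
        rw [ih l (Finset.mem_range.mp hl) _ (List.length_ofFn), zero_mul]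
    subst hk
    set g : Fin α.length → Fin n := α.get
    have hinv : jacobianZero f * (jacobianZero f)⁻¹ = 1 :=
      Matrix.mul_nonsing_inv _ (isUnit_iff_ne_zero.mpr hdet)
    have hprod : ∀ w : Fin α.length → Fin n, ∑ d : Fin α.length → Fin n,
        (∏ i, jacobianZero f (w i) (d i)) * ∏ i, (jacobianZero f)⁻¹ (d i) (g i) =
          if w = g then 1 else 0 := by
      intro w
      simp only [← Finset.prod_mul_distrib]
      rw [← Fintype.prod_sum fun i d => jacobianZero f (w i) d * (jacobianZero f)⁻¹ d (g i)]
      simp only [← Matrix.mul_apply, hinv, Matrix.one_apply]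
      rw [Finset.prod_ite_zero]
      simp [funext_iff]
    have hsum : ∑ d : Fin α.length → Fin n, (∑ w : Fin α.length → Fin n,
        c (List.ofFn w) * ∏ i, jacobianZero f (w i) (d i)) *
          ∏ i, (jacobianZero f)⁻¹ (d i) (g i) = c α := by
      simp only [Finset.sum_mul]
      rw [Finset.sum_comm]
      simp only [mul_assoc, ← Finset.mul_sum, hprod]
      simp [g]
    rw [← hsum]
    exact Finset.sum_eq_zero fun d _ => by rw [hcoef, zero_mul]

theorem _root_.NCVariety.RepSeries.unique (hf : ∀ i, f i [] = 0) (hdet : (jacobianZero f).det ≠ 0)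
    {a b : H2 n} {F : NCSeries n} (ha : RepSeries f a F) (hb : RepSeries f b F) : a = b := by
  refine lp.ext (funext fun α => sub_eq_zero.mp ?_)
  refine eq_zero_of_formalComp_eq_zero hf hdet (c := fun α => a α - b α) (fun δ => ?_) α
  rw [formalComp_sub, ← show F = formalComp (fun α => a α) f from ha,
    ← show F = formalComp (fun α => b α) f from hb, sub_self]

end NCSeries

/-! ### Tuples with property `(𝒮)`. -/

section PropertyS

variable {n : ℕ} {f : Fin n → NCSeries n} {M : Fin n → (H2 n →L[ℂ] H2 n)}

theorem PropertyS.comp_rightOp (h : PropertyS f M) (i : Fin n) (β : List (Fin n)) :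
    M i ∘L rightOp β = rightOp β ∘L M i :=
  (h.mult i).comp_rightOp (Rep := RepSeries f) (w := wordProd f)
    (fun α => (NCSeries.formalComp_wordBasis h.map_zero α).symm)
    (fun a _ α hF => (congrArg (· * wordProd f α) hF).trans
      (NCSeries.formalComp_rightOp h.map_zero a α).symm)
    (fun _ _ _ ha hb => RepSeries.unique h.map_zero h.jacobian ha hb)
    (fun u α => congrArg (· * wordProd f α) (NCSeries.mul_one u)) β

theorem PropertyS.exists_seq (h : PropertyS f M) (j : Fin n) : ∃ T : ℕ → (H2 n →L[ℂ] H2 n),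
      (∀ m, T m ∈ closure (Algebra.adjoin ℂ (Set.range M) : Set (H2 n →L[ℂ] H2 n))) ∧
      ∀ x, Filter.Tendsto (fun m => T m x) Filter.atTop (𝓝 (leftOp [j] x)) := by
  obtain ⟨Mf, hMf, heval⟩ := h.eval
  have hL : Mf j = leftOp [j] :=
    (hMf j).eq_leftOp (Rep := RepSeries f) (w := wordProd f)
      (fun α => (NCSeries.formalComp_wordBasis h.map_zero α).symm)
      (fun _ _ _ ha hb => RepSeries.unique h.map_zero h.jacobian ha hb) fun α => (wordProd_cons f j α).symm
  rw [← hL]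
  exact heval.exists_seq j

end PropertyS

/-! ### Free holomorphic functions on the operatorial ball -/

section NormEvaluation

variable {n : ℕ} {H : Type*} [NormedAddCommGroup H] [InnerProductSpace ℂ H]

theorem evalNorm_wordBasis (X : Fin n → (H →L[ℂ] H)) (α : List (Fin n)) :
    EvalNorm (fun β => wordBasis n α β) X (wordProd X α) := by
  refine tendsto_const_nhds.congr' ?_
  filter_upwards [Filter.eventually_gt_atTop α.length] with m hm
  rw [partialEval_eq_sum, Finset.sum_eq_single α]
  · simp [wordBasis_apply]
  · intro β _ hβ
    simp [wordBasis_apply, hβ]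
  · intro h
    exact absurd (mem_wordsLT.mpr hm) h

theorem EvalNorm.rightOp {a : H2 n} {X : Fin n → (H →L[ℂ] H)} {V : H →L[ℂ] H}
    (h : EvalNorm (fun β => a β) X V) (α : List (Fin n)) :
    EvalNorm (fun β => rightOp α a β) X (V * wordProd X α) := by
  -- The partial sum of order `m + |α|` for `R_α a` equals the partial sum of order `m` for `a`,
  -- times `X_α`.
  refine (Filter.tendsto_add_atTop_iff_nat α.length).mp ?_
  refine (Filter.Tendsto.mul_const (wordProd X α) h).congr fun m => ?_
  rw [partialEval_eq_sum, partialEval_eq_sum, sum_wordsLT_append _ α, Finset.sum_mul]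
  · refine Finset.sum_congr rfl fun γ _ => ?_
    rw [rightOp_apply_append, wordProd_append, smul_mul_assoc]
  · intro δ hδ
    rw [rightOp_apply_eq_zero _ hδ, zero_smul]

theorem EvalNorm.sub {a b : List (Fin n) → ℂ} {X : Fin n → (H →L[ℂ] H)} {V W : H →L[ℂ] H}
    (ha : EvalNorm a X V) (hb : EvalNorm b X W) : EvalNorm (fun α => a α - b α) X (V - W) := by
  refine (Filter.Tendsto.sub ha hb).congr fun m => ?_
  simp only [partialEval_eq_sum, sub_smul, Finset.sum_sub_distrib]

end NormEvaluation

/-! ### Norm convergence on the operatorial unit ball. -/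

section RowContractions

variable {n : ℕ} {H : Type*} [NormedAddCommGroup H] [InnerProductSpace ℂ H] [CompleteSpace H]

theorem sum_norm_adjoint_sq_le (Y : Fin n → (H →L[ℂ] H)) (y : H) :
    ∑ i, ‖ContinuousLinearMap.adjoint (Y i) y‖ ^ 2 ≤
      ‖∑ i, Y i * ContinuousLinearMap.adjoint (Y i)‖ * ‖y‖ ^ 2 := by
  have h : ((∑ i, ‖ContinuousLinearMap.adjoint (Y i) y‖ ^ 2 : ℝ) : ℂ) =
      inner ℂ ((∑ i, Y i * ContinuousLinearMap.adjoint (Y i)) y) y := by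
    rw [sum_apply, sum_inner]
    push_cast
    refine Finset.sum_congr rfl fun i _ => ?_
    change _ = inner ℂ (Y i (ContinuousLinearMap.adjoint (Y i) y)) y
    rw [← ContinuousLinearMap.adjoint_inner_right, inner_self_eq_norm_sq_to_K]
    rfl
  calc _ = ‖((∑ i, ‖ContinuousLinearMap.adjoint (Y i) y‖ ^ 2 : ℝ) : ℂ)‖ := by
        rw [Complex.norm_real, Real.norm_of_nonneg (by positivity)]
    _ ≤ ‖(∑ i, Y i * ContinuousLinearMap.adjoint (Y i)) y‖ * ‖y‖ := by
        rw [h]; exact norm_inner_le_norm _ _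
    _ ≤ ‖∑ i, Y i * ContinuousLinearMap.adjoint (Y i)‖ * ‖y‖ * ‖y‖ := by
        gcongr; exact ContinuousLinearMap.le_opNorm _ _
    _ = _ := by ring

/-- Iteration of the one-letter bound: the adjoint of `Y_i Y_w` is `Y_w* Y_i*`, so the induction
hypothesis is used at `Y_i* y`. -/
theorem sum_norm_adjoint_wordProd_sq_le (Y : Fin n → (H →L[ℂ] H)) (k : ℕ) (y : H) :
    ∑ w : Fin k → Fin n, ‖ContinuousLinearMap.adjoint (wordProd Y (List.ofFn w)) y‖ ^ 2 ≤
      ‖∑ i, Y i * ContinuousLinearMap.adjoint (Y i)‖ ^ k * ‖y‖ ^ 2 := by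
  induction k generalizing y with
  | zero =>
    have h1 : ContinuousLinearMap.adjoint (1 : H →L[ℂ] H) = 1 := by
      rw [← ContinuousLinearMap.star_eq_adjoint, star_one]
    simp [wordProd, h1]
  | succ k ih =>
    rw [← (Fin.consEquiv fun _ => Fin n).sum_comp, Fintype.sum_prod_type]
    calc _ = ∑ i, ∑ w : Fin k → Fin n, ‖ContinuousLinearMap.adjoint (wordProd Y (List.ofFn w))
          (ContinuousLinearMap.adjoint (Y i) y)‖ ^ 2 := by
          refine Finset.sum_congr rfl fun i _ => Finset.sum_congr rfl fun w _ => ?_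
          have : List.ofFn ((Fin.consEquiv fun _ => Fin n) (i, w)) = i :: List.ofFn w := by
            simp [Fin.consEquiv, List.ofFn_succ]
          rw [this, wordProd_cons, ContinuousLinearMap.mul_def, ContinuousLinearMap.adjoint_comp]
          rfl
      _ ≤ ∑ i, ‖∑ i, Y i * ContinuousLinearMap.adjoint (Y i)‖ ^ k *
          ‖ContinuousLinearMap.adjoint (Y i) y‖ ^ 2 := Finset.sum_le_sum fun i _ => ih _
      _ ≤ ‖∑ i, Y i * ContinuousLinearMap.adjoint (Y i)‖ ^ k *
          (‖∑ i, Y i * ContinuousLinearMap.adjoint (Y i)‖ * ‖y‖ ^ 2) := by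
          rw [← Finset.mul_sum]
          gcongr
          exact sum_norm_adjoint_sq_le Y y
      _ = _ := by ring

/-- The image `y` of `x` is paired with itself, the words are moved to adjoints acting on `y`, and
Cauchy–Schwarz is applied to the sum over words. -/
theorem norm_homogeneous_le (Y : Fin n → (H →L[ℂ] H)) (k : ℕ) (a : (Fin k → Fin n) → ℂ) :
    ‖∑ w, a w • wordProd Y (List.ofFn w)‖ ≤
      √(∑ w, ‖a w‖ ^ 2) * √‖∑ i, Y i * ContinuousLinearMap.adjoint (Y i)‖ ^ k := by
  set q := ‖∑ i, Y i * ContinuousLinearMap.adjoint (Y i)‖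
  refine ContinuousLinearMap.opNorm_le_bound _ (by positivity) fun x => ?_
  set y := (∑ w, a w • wordProd Y (List.ofFn w)) x
  have h1 : ‖y‖ * ‖y‖ ≤
      ∑ w, ‖a w‖ * (‖ContinuousLinearMap.adjoint (wordProd Y (List.ofFn w)) y‖ * ‖x‖) := by
    rw [← inner_self_eq_norm_mul_norm (𝕜 := ℂ) y]
    refine (RCLike.re_le_norm _).trans ?_
    have h0 : inner ℂ y y = inner ℂ (∑ w, (a w • wordProd Y (List.ofFn w)) x) y := by
      rw [← sum_apply]
    rw [h0, sum_inner]
    refine (norm_sum_le _ _).trans (Finset.sum_le_sum fun w _ => ?_)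
    rw [smul_apply, inner_smul_left, norm_mul, RCLike.norm_conj,
      ← ContinuousLinearMap.adjoint_inner_right, mul_comm ‖ContinuousLinearMap.adjoint _ y‖]
    gcongr
    exact norm_inner_le_norm _ _
  have h2 : ∑ w, ‖a w‖ * ‖ContinuousLinearMap.adjoint (wordProd Y (List.ofFn w)) y‖ ≤
      √(∑ w, ‖a w‖ ^ 2) * (√q ^ k * ‖y‖) := by
    refine (Real.sum_mul_le_sqrt_mul_sqrt _ _ _).trans ?_
    gcongr
    refine Real.sqrt_le_iff.mpr ⟨by positivity, ?_⟩
    rw [mul_pow, ← pow_mul, mul_comm k, pow_mul, Real.sq_sqrt (norm_nonneg _)]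
    exact sum_norm_adjoint_wordProd_sq_le Y k y
  have h3 : ‖y‖ * ‖y‖ ≤ √(∑ w, ‖a w‖ ^ 2) * √q ^ k * ‖x‖ * ‖y‖ := by
    calc _ ≤ _ := h1
      _ = (∑ w, ‖a w‖ * ‖ContinuousLinearMap.adjoint (wordProd Y (List.ofFn w)) y‖) * ‖x‖ := by
          rw [Finset.sum_mul]
          exact Finset.sum_congr rfl fun w _ => by ring
      _ ≤ (√(∑ w, ‖a w‖ ^ 2) * (√q ^ k * ‖y‖)) * ‖x‖ := by gcongr
      _ = _ := by ring
  rcases (norm_nonneg y).eq_or_lt with h0 | h0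
  · rw [← h0]; positivity
  · exact le_of_mul_le_mul_right h3 h0

theorem sum_ofFn_norm_sq_le (a : H2 n) (k : ℕ) :
    ∑ w : Fin k → Fin n, ‖a (List.ofFn w)‖ ^ 2 ≤ ‖a‖ ^ 2 := by
  have h := ((wordBasis n).orthonormal.comp (fun w : Fin k → Fin n => List.ofFn w)
    List.ofFn_injective).sum_inner_products_le a (s := Finset.univ)
  simpa only [Function.comp_apply, inner_wordBasis] using h

/-- Series with square summable coefficients converge in norm on the open unit ball. -/
theorem exists_evalNorm (a : H2 n) {Y : Fin n → (H →L[ℂ] H)} (hY : Y ∈ opBall n H 1) :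
    ∃ V, EvalNorm (fun α => a α) Y V := by
  have hq : √‖∑ i, Y i * ContinuousLinearMap.adjoint (Y i)‖ < 1 := hY
  have hs : Summable fun k : ℕ =>
      ∑ w : Fin k → Fin n, a (List.ofFn w) • wordProd Y (List.ofFn w) := by
    refine Summable.of_norm_bounded
      ((summable_geometric_of_lt_one (Real.sqrt_nonneg _) hq).mul_left ‖a‖) fun k => ?_
    refine (norm_homogeneous_le Y k _).trans ?_
    gcongr
    exact Real.sqrt_le_iff.mpr ⟨norm_nonneg _, sum_ofFn_norm_sq_le a k⟩
  exact ⟨_, hs.hasSum.tendsto_sum_nat⟩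

variable {γ : ℝ} {φ : (Fin n → (H →L[ℂ] H)) → (Fin n → (H →L[ℂ] H))}

theorem repHol_wordBasis (α : List (Fin n)) :
    RepHol γ φ (wordBasis n α) (fun X => wordProd (φ X) α) :=
  fun X _ => evalNorm_wordBasis (φ X) α

/-- The difference of two representing series converges on the unit ball, being square summable, and
vanishes after composition with `φ`. So `hφ` applies to it. -/
theorem RepHol.unique
    (hφ : ∀ G : NCSeries n, (∀ Y ∈ opBall n H 1, ∃ V, EvalNorm G Y V) →
      (∀ X ∈ opBall n H γ, EvalNorm G (φ X) 0) → ∀ α, G α = 0)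
    {a b : H2 n} {F : (Fin n → (H →L[ℂ] H)) → (H →L[ℂ] H)} (ha : RepHol γ φ a F)
    (hb : RepHol γ φ b F) : a = b := by
  refine lp.ext (funext fun α => sub_eq_zero.mp ?_)
  refine hφ (fun α => a α - b α) (fun Y hY => ?_) (fun X hX => ?_) α
  · exact exists_evalNorm (a - b) hY
  · have := (ha X hX).sub (hb X hX)
    rwa [sub_self] at this

end RowContractions

/-! ### Tuples with property `(ℱ)`. -/

section PropertyF

variable {n : ℕ} {H : Type*} [NormedAddCommGroup H] [InnerProductSpace ℂ H] [CompleteSpace H]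
  {f : Fin n → NCSeries n} {M : Fin n → (H2 n →L[ℂ] H2 n)}

theorem PropertyF.comp_rightOp (h : PropertyF H f M) (i : Fin n) (β : List (Fin n)) :
    M i ∘L rightOp β = rightOp β ∘L M i := by
  obtain ⟨γ, -, φ, -, -, hφ, -, hM, -⟩ := h
  exact (hM i).comp_rightOp (Rep := RepHol γ φ) (w := fun α X => wordProd (φ X) α)
    repHol_wordBasis (fun a F α h X hX => (h X hX).rightOp α)
    (fun _ _ _ ha hb => RepHol.unique hφ ha hb)
    (fun u α => funext fun X => by simp [wordProd]) β

theorem PropertyF.exists_seq (h : PropertyF H f M) (j : Fin n) : ∃ T : ℕ → (H2 n →L[ℂ] H2 n),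
      (∀ m, T m ∈ closure (Algebra.adjoin ℂ (Set.range M) : Set (H2 n →L[ℂ] H2 n))) ∧
      ∀ x, Filter.Tendsto (fun m => T m x) Filter.atTop (𝓝 (leftOp [j] x)) := by
  obtain ⟨γ, -, φ, -, -, hφ, -, -, Mf, hMf, heval⟩ := h
  have hL : Mf j = leftOp [j] :=
    (hMf j).eq_leftOp (Rep := RepHol γ φ) (w := fun α X => wordProd (φ X) α)
      repHol_wordBasis (fun _ _ _ ha hb => RepHol.unique hφ ha hb)
      fun α => funext fun X => (wordProd_cons (φ X) j α).symm
  rw [← hL]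
  exact heval.exists_seq j

end PropertyF

/-! ### The three cases of the model property together. -/

section ModelProperty

variable {n : ℕ} {H : Type*} [NormedAddCommGroup H] [InnerProductSpace ℂ H] [CompleteSpace H]
  {f : Fin n → NCSeries n} {M : Fin n → (H2 n →L[ℂ] H2 n)}

theorem HasModelProperty.comp_rightOp (h : HasModelProperty H f M) (i : Fin n)
    (β : List (Fin n)) : M i ∘L rightOp β = rightOp β ∘L M i := by
  rcases h with h | h | h
  · exact h.comp_rightOp i β
  · exact h.comp_rightOp i β
  · exact h.comp_rightOp i β

theorem HasModelProperty.exists_seq (h : HasModelProperty H f M) (j : Fin n) :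
    ∃ T : ℕ → (H2 n →L[ℂ] H2 n),
      (∀ m, T m ∈ closure (Algebra.adjoin ℂ (Set.range M) : Set (H2 n →L[ℂ] H2 n))) ∧
      ∀ x, Filter.Tendsto (fun m => T m x) Filter.atTop (𝓝 (leftOp [j] x)) := by
  rcases h with h | h | h
  · exact h.exists_seq j
  · exact h.exists_seq j
  · exact h.exists_seq j

end ModelProperty

end

end NCVariety

theorem theorem6p1 {n : ℕ}
    {H : Type u} [NormedAddCommGroup H] [InnerProductSpace ℂ H] [CompleteSpace H]
    (hH : ¬ FiniteDimensional ℂ H)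
    (f : Fin n → NCVariety.NCSeries n)
    (M : Fin n → (NCVariety.H2 n →L[ℂ] NCVariety.H2 n))
    (hf : NCVariety.HasModelProperty H f M)
    (J : Submodule ℂ (NCVariety.H2 n →L[ℂ] NCVariety.H2 n))
    (hJ : NCVariety.IsWOTClosedIdeal (NCVariety.hardyAlgebra M) J)
    (hJne : (J : Set (NCVariety.H2 n →L[ℂ] NCVariety.H2 n)) ≠ NCVariety.hardyAlgebra M)
    {K : Type v} [NormedAddCommGroup K] [InnerProductSpace ℂ K] [CompleteSpace K]
    (𝓜 : Submodule ℂ (NCVariety.HilbertTensor (NCVariety.varietySpace J) K))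
    (h𝓜 : IsClosed (𝓜 : Set (NCVariety.HilbertTensor (NCVariety.varietySpace J) K))) :
    (∀ i, ∀ x ∈ 𝓜, NCVariety.ampliation K (NCVariety.universalModel M J i) x ∈ 𝓜) ↔
    ∃ (G : Type v) (_ : NormedAddCommGroup G) (_ : InnerProductSpace ℂ G) (_ : CompleteSpace G)
      (Θ : NCVariety.HilbertTensor (NCVariety.varietySpace J) G →L[ℂ]
        NCVariety.HilbertTensor (NCVariety.varietySpace J) K),
      NCVariety.IsPartialIsometry (E := NCVariety.HilbertTensor (NCVariety.varietySpace J) G)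
        (F := NCVariety.HilbertTensor (NCVariety.varietySpace J) K) Θ ∧
      (∀ i, Θ ∘L NCVariety.ampliation G (NCVariety.universalModel M J i) =
        NCVariety.ampliation K (NCVariety.universalModel M J i) ∘L Θ) ∧
      (𝓜 : Set (NCVariety.HilbertTensor (NCVariety.varietySpace J) K)) = Set.range Θ := by
  constructor
  · intro hinv
    exact NCVariety.exists_partialIsometry_varietySpace hf.comp_rightOp hf.exists_seq hJ h𝓜 hinv
  · rintro ⟨G, _, _, _, Θ, -, hΘ, hrange⟩ i x hx
    have hmem : ∀ z, z ∈ 𝓜 ↔ z ∈ Set.range Θ := fun z => by rw [← hrange]; rfl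
    obtain ⟨y, rfl⟩ := (hmem x).mp hx
    rw [← ContinuousLinearMap.comp_apply, ← hΘ i, hmem]
    exact ⟨_, rfl⟩
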